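/- Identify $\mathbb R^2$ with $\mathbb C$ by $z=x+iy$ and write $x^\perp$ for the rotation of $x$ by $\pi/2$. For $f_1,f_2,f_3,f_4:\mathbb R^2\to\mathbb C$ let $$\mathcal T(f_1,f_2,f_3)(z)=\int_{\mathbb R}\int_{\mathbb R^2} f_1(x+z)\,f_2(\lambda x^\perp+z)\,\overline{f_3(x+\lambda x^\perp+z)}\,dx\,d\lambda,\qquad \mathcal E(f_1,f_2,f_3,f_4)=\int_{\mathbb R^2}\mathcal T(f_1,f_2,f_3)\,\overline{f_4}\,dz .$$ Let $a_d^\star=\tfrac12(z-2\partial_{\bar z})$, $a_g^\star=\tfrac12(\bar z-2\partial_z)$ and, for integers $n\ge 0$ and $-n\le m\le n$ with $n+m$ even, let $$\varphi_{n,m}=\frac{1}{\sqrt{\pi\,p!\,q!}}\,(a_d^\star)^{p}(a_g^\star)^{q}e^{-|z|^2/2},\qquad p=\tfrac{n+m}2,\quad q=\tfrac{n-m}2$$ be the special Hermite functions; put $\varphi_{n,m}=0$ for all other $(n,m)\in\mathbb Z^2$. Write $\varphi_j=\varphi_{n_j,m_j}$. (i) The integrals defining $\mathcal T(\varphi_1,\varphi_2,\varphi_3)(z)$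 converge absolutely for every $z$, and $$\mathcal E(\varphi_1,\varphi_2,\varphi_3,\varphi_4)=2\pi^2\Big(\int_{\mathbb R^2}\varphi_1\varphi_2\overline{\varphi_3\varphi_4}\,dx\Big)\mathbf 1_{\{n_1+n_2=n_3+n_4,\ m_1+m_2=m_3+m_4\}} .$$ (ii) If $n_4=n_1+n_2-n_3$ and $m_4=m_1+m_2-m_3$, then, at every point, $$\mathcal T(\varphi_1,\varphi_2,\varphi_3)=\mathcal E(\varphi_1,\varphi_2,\varphi_3,\varphi_4)\,\varphi_4=2\pi^2\Big(\int_{\mathbb R^2}\varphi_1\varphi_2\overline{\varphi_3\varphi_4}\,dx\Big)\varphi_4 .$$ (iii) $\int_{\mathbb R^2}\varphi_1\varphi_2\overline{\varphi_3\varphi_4}\,dx=0$ whenever $m_1+m_2\ne m_3+m_4$. Consider the equation $i\partial_tu=\mathcal T(u,u,u)$, whose solutions on a time interval are the $L^2(\mathbb R^2)$-valued functions that are differentiable in time and satisfy the equation in $L^2(\mathbb R^2)$ at every time of the interval. (iv) Every $\varphi_{n,m}$ is a stationary wave: the number $\omega=\mathcal E(\varphi_{n,m},\varphi_{n,m},\varphi_{n,m},\varphi_{n,m})$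 is real and $t\mapsto e^{-i\omega t}\varphi_{n,m}$ is a solution on $\mathbb R$. (v) For all integers $\alpha,\beta,\gamma,\delta$, the closed linear spans in $L^2(\mathbb R^2)$ of $\{\varphi_{n,m}:\alpha n+\beta m\equiv\gamma \bmod\delta\}$ and of $\{\varphi_{n,m}:\alpha n+\beta m=\gamma\}$ are dynamically invariant: every solution, on any time interval, that belongs to the subspace at one time of the interval belongs to it at all times of the interval. -/

import Mathlib

open MeasureTheory

namespace ContinuousResonant

/-! The plane `ℝ²` is identified with `ℂ` through `z = x₁ + i x₂`; `volume` on `ℂ` is then the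
two-dimensional Lebesgue measure and `x^⊥ = i x` is the rotation of `x` by `π / 2`. -/

/-- The integrand `f₁(x + z) f₂(λ x^⊥ + z) conj (f₃(x + λ x^⊥ + z))` of the trilinear operator. -/
noncomputable def resonantIntegrand (f₁ f₂ f₃ : ℂ → ℂ) (z : ℂ) (l : ℝ) (x : ℂ) : ℂ :=
  f₁ (x + z) * f₂ ((l : ℂ) * (Complex.I * x) + z) *
    starRingEnd ℂ (f₃ (x + (l : ℂ) * (Complex.I * x) + z))

/-- The trilinear operator `𝓣(f₁, f₂, f₃)(z) = ∫_ℝ ∫_{ℝ²} … dx dλ`. -/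
noncomputable def resonantT (f₁ f₂ f₃ : ℂ → ℂ) (z : ℂ) : ℂ :=
  ∫ l : ℝ, ∫ x : ℂ, resonantIntegrand f₁ f₂ f₃ z l x

/-- `𝓔(f₁, f₂, f₃, f₄) = ⟨𝓣(f₁, f₂, f₃), f₄⟩ = ∫ 𝓣(f₁, f₂, f₃) conj f₄`. -/
noncomputable def resonantE (f₁ f₂ f₃ f₄ : ℂ → ℂ) : ℂ :=
  ∫ z : ℂ, resonantT f₁ f₂ f₃ z * starRingEnd ℂ (f₄ z)

/-- `∂_x f`. -/
noncomputable def partialX (f : ℂ → ℂ) (z : ℂ) : ℂ := fderiv ℝ f z 1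

/-- `∂_y f`. -/
noncomputable def partialY (f : ℂ → ℂ) (z : ℂ) : ℂ := fderiv ℝ f z Complex.I

/-- `∂_z = (∂_x - i ∂_y) / 2`. -/
noncomputable def wirtingerD (f : ℂ → ℂ) (z : ℂ) : ℂ :=
  (1 / 2) * (partialX f z - Complex.I * partialY f z)

/-- `∂_{z̄} = (∂_x + i ∂_y) / 2`. -/
noncomputable def wirtingerDbar (f : ℂ → ℂ) (z : ℂ) : ℂ :=
  (1 / 2) * (partialX f z + Complex.I * partialY f z)

/-- The creation operator `a_d^* = (z - 2 ∂_{z̄}) / 2`. -/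
noncomputable def creationD (f : ℂ → ℂ) (z : ℂ) : ℂ :=
  (1 / 2) * (z * f z - 2 * wirtingerDbar f z)

/-- The creation operator `a_g^* = (z̄ - 2 ∂_z) / 2`. -/
noncomputable def creationG (f : ℂ → ℂ) (z : ℂ) : ℂ :=
  (1 / 2) * (starRingEnd ℂ z * f z - 2 * wirtingerD f z)

/-- The Gaussian `exp (- z z̄ / 2)`. -/
noncomputable def gaussian (z : ℂ) : ℂ := Complex.exp (-(z * starRingEnd ℂ z) / 2)

/-- `ψ_{n,m} = (π n! m!)^{-1/2} (a_d^*)^n (a_g^*)^m exp (- z z̄ / 2)`. -/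
noncomputable def specialHermitePsi (n m : ℕ) (z : ℂ) : ℂ :=
  ((1 / Real.sqrt (Real.pi * n.factorial * m.factorial) : ℝ) : ℂ) *
    (creationD^[n] (creationG^[m] gaussian)) z

/-- The special Hermite function `φ_{n,m} = ψ_{(n+m)/2, (n-m)/2}` for `n ≥ 0`, `-n ≤ m ≤ n` and
`n + m` even, with the convention `φ_{n,m} = 0` for every other pair of integers. -/
noncomputable def specialHermite (n m : ℤ) : ℂ → ℂ :=
  if |m| ≤ n ∧ Even (n + m) then
    specialHermitePsi ((n + m) / 2).toNat ((n - m) / 2).toNat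
  else 0

/-- The monomial `z^a z̄^b` times the Gaussian. -/
noncomputable def monomialGaussian (a b : ℕ) (z : ℂ) : ℂ :=
  z ^ a * (starRingEnd ℂ z) ^ b * gaussian z

lemma hasFDerivAt_monomialGaussian (a b : ℕ) (z : ℂ) :
    HasFDerivAt (𝕜 := ℝ) (monomialGaussian a b)
      (((a * z ^ (a - 1) * (starRingEnd ℂ z) ^ b * gaussian z
          - (1 / 2) * monomialGaussian a (b + 1) z) • (ContinuousLinearMap.id ℝ ℂ)) +
        ((b * z ^ a * (starRingEnd ℂ z) ^ (b - 1) * gaussian z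
          - (1 / 2) * monomialGaussian (a + 1) b z) • (Complex.conjCLE : ℂ →L[ℝ] ℂ))) z := by
  have h1 : HasFDerivAt (𝕜 := ℝ) (fun z : ℂ => z) (ContinuousLinearMap.id ℝ ℂ) z := hasFDerivAt_id z
  have h2 : HasFDerivAt (𝕜 := ℝ) (fun z : ℂ => starRingEnd ℂ z) (Complex.conjCLE : ℂ →L[ℝ] ℂ) z :=
    (Complex.conjCLE : ℂ →L[ℝ] ℂ).hasFDerivAt
  have h3 := ((h1.mul h2).neg.mul_const (1 / 2 : ℂ)).cexp
  have h := ((h1.pow a).mul (h2.pow b)).mul h3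
  have e : monomialGaussian a b = fun z : ℂ => z ^ a * (starRingEnd ℂ z) ^ b *
      Complex.exp (-(z * starRingEnd ℂ z) * (1 / 2)) := by
    funext w; simp only [monomialGaussian, gaussian]; ring_nf
  rw [e]
  refine h.congr_fderiv ?_
  ext v
  simp [monomialGaussian, gaussian]
  ring_nf

lemma creationD_monomialGaussian (a b : ℕ) :
    creationD (monomialGaussian a b) =
      monomialGaussian (a + 1) b - (b : ℂ) • monomialGaussian a (b - 1) := by
  funext z
  simp only [creationD, wirtingerDbar, partialX, partialY,
    (hasFDerivAt_monomialGaussian a b z).fderiv]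
  simp [monomialGaussian]
  ring_nf
  simp
  ring

lemma creationG_monomialGaussian (a b : ℕ) :
    creationG (monomialGaussian a b) =
      monomialGaussian a (b + 1) - (a : ℂ) • monomialGaussian (a - 1) b := by
  funext z
  simp only [creationG, wirtingerD, partialX, partialY,
    (hasFDerivAt_monomialGaussian a b z).fderiv]
  simp [monomialGaussian]
  ring_nf
  simp
  ring

/-- The functions (polynomial in `z, z̄`) times the Gaussian. -/
noncomputable def polyGaussian : Submodule ℂ (ℂ → ℂ) :=
  Submodule.span ℂ (Set.range fun p : ℕ × ℕ => monomialGaussian p.1 p.2)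

lemma monomialGaussian_mem (a b : ℕ) : monomialGaussian a b ∈ polyGaussian :=
  Submodule.subset_span ⟨(a, b), rfl⟩

lemma differentiable_of_mem {f : ℂ → ℂ} (hf : f ∈ polyGaussian) : Differentiable ℝ f := by
  induction hf using Submodule.span_induction with
  | mem x h =>
    obtain ⟨p, rfl⟩ := h
    exact fun z => (hasFDerivAt_monomialGaussian p.1 p.2 z).differentiableAt
  | zero => exact differentiable_const 0
  | add x y _ _ hx hy => exact hx.add hy
  | smul c x _ hx => exact hx.const_smul c

lemma creationD_mem {f : ℂ → ℂ} (hf : f ∈ polyGaussian) : creationD f ∈ polyGaussian := by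
  induction hf using Submodule.span_induction with
  | mem x h =>
    obtain ⟨p, rfl⟩ := h
    rw [creationD_monomialGaussian]
    exact sub_mem (monomialGaussian_mem _ _)
      (Submodule.smul_mem _ _ (monomialGaussian_mem _ _))
  | zero =>
    have : creationD 0 = 0 := by
      funext z; simp [creationD, wirtingerDbar, partialX, partialY]
    rw [this]; exact zero_mem _
  | add x y h1 h2 hx hy =>
    have : creationD (x + y) = creationD x + creationD y := by
      funext z
      simp only [creationD, wirtingerDbar, partialX, partialY, Pi.add_apply,
        fderiv_add (differentiable_of_mem h1 z) (differentiable_of_mem h2 z),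
        add_apply]
      ring
    rw [this]; exact add_mem hx hy
  | smul c x h1 hx =>
    have : creationD (c • x) = c • creationD x := by
      funext z
      simp only [creationD, wirtingerDbar, partialX, partialY, Pi.smul_apply,
        fderiv_const_smul (differentiable_of_mem h1 z) c, smul_apply,
        smul_eq_mul]
      ring
    rw [this]; exact Submodule.smul_mem _ _ hx

lemma creationG_mem {f : ℂ → ℂ} (hf : f ∈ polyGaussian) : creationG f ∈ polyGaussian := by
  induction hf using Submodule.span_induction with
  | mem x h =>
    obtain ⟨p, rfl⟩ := h
    rw [creationG_monomialGaussian]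
    exact sub_mem (monomialGaussian_mem _ _)
      (Submodule.smul_mem _ _ (monomialGaussian_mem _ _))
  | zero =>
    have : creationG 0 = 0 := by
      funext z; simp [creationG, wirtingerD, partialX, partialY]
    rw [this]; exact zero_mem _
  | add x y h1 h2 hx hy =>
    have : creationG (x + y) = creationG x + creationG y := by
      funext z
      simp only [creationG, wirtingerD, partialX, partialY, Pi.add_apply,
        fderiv_add (differentiable_of_mem h1 z) (differentiable_of_mem h2 z),
        add_apply]
      ring
    rw [this]; exact add_mem hx hy
  | smul c x h1 hx =>
    have : creationG (c • x) = c • creationG x := by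
      funext z
      simp only [creationG, wirtingerD, partialX, partialY, Pi.smul_apply,
        fderiv_const_smul (differentiable_of_mem h1 z) c, smul_apply,
        smul_eq_mul]
      ring
    rw [this]; exact Submodule.smul_mem _ _ hx

lemma specialHermite_mem (n m : ℤ) : specialHermite n m ∈ polyGaussian := by
  have h0 : gaussian ∈ polyGaussian := by
    have : gaussian = monomialGaussian 0 0 := by funext z; simp [monomialGaussian]
    rw [this]; exact monomialGaussian_mem 0 0
  have hG : ∀ k : ℕ, creationG^[k] gaussian ∈ polyGaussian := fun k => by
    induction k with
    | zero => exact h0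
    | succ k ih => rw [Function.iterate_succ_apply']; exact creationG_mem ih
  have hD : ∀ k l : ℕ, creationD^[k] (creationG^[l] gaussian) ∈ polyGaussian := fun k l => by
    induction k with
    | zero => exact hG l
    | succ k ih => rw [Function.iterate_succ_apply']; exact creationD_mem ih
  unfold specialHermite
  split_ifs
  · exact Submodule.smul_mem polyGaussian _ (hD _ _)
  · exact zero_mem _

lemma memLp_monomialGaussian (a b : ℕ) : MemLp (monomialGaussian a b) 2 (volume : Measure ℂ) := by
  have hc : Continuous (monomialGaussian a b) :=
    (differentiable_of_mem (monomialGaussian_mem a b)).continuous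
  rw [memLp_two_iff_integrable_sq_norm hc.aestronglyMeasurable]
  have e : ∀ z : ℂ, ‖monomialGaussian a b z‖ ^ 2 =
      (fun r : ℝ => r ^ (2 * (a + b)) * Real.exp (-1 * r ^ 2)) ‖z‖ := fun z => by
    have : ‖gaussian z‖ = Real.exp (-(1 / 2) * ‖z‖ ^ 2) := by
      rw [gaussian, Complex.norm_exp, Complex.mul_conj, Complex.normSq_eq_norm_sq]
      congr 1
      rw [← Complex.ofReal_neg]
      have : ((-‖z‖ ^ 2 : ℝ) : ℂ) / 2 = ((-‖z‖ ^ 2 / 2 : ℝ) : ℂ) := by push_cast; ring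
      rw [this, Complex.ofReal_re]; ring
    simp only [monomialGaussian, norm_mul, norm_pow, this, RCLike.norm_conj]
    rw [mul_pow, ← Real.exp_nat_mul]
    congr 1
    · ring
    · congr 1; push_cast; ring
  simp_rw [e]
  refine (integrable_fun_norm_addHaar (volume : Measure ℂ)
    (f := fun r : ℝ => r ^ (2 * (a + b)) * Real.exp (-1 * r ^ 2))).2 ?_
  have h := (integrable_rpow_mul_exp_neg_mul_sq (b := 1) one_pos
    (s := (2 * (a + b) + 1 : ℕ)) (by
      have : (0 : ℝ) ≤ ((2 * (a + b) + 1 : ℕ) : ℝ) := by positivity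
      linarith)).integrableOn (s := Set.Ioi 0)
  refine h.congr_fun (fun r _ => ?_) measurableSet_Ioi
  simp only [Complex.finrank_real_complex, Real.rpow_natCast, smul_eq_mul]
  ring_nf

lemma memLp_specialHermite (n m : ℤ) : MemLp (specialHermite n m) 2 (volume : Measure ℂ) := by
  have key : ∀ f ∈ polyGaussian, MemLp f 2 (volume : Measure ℂ) := fun f hf => by
    induction hf using Submodule.span_induction with
    | mem x h => obtain ⟨p, rfl⟩ := h; exact memLp_monomialGaussian p.1 p.2
    | zero => exact MemLp.zero
    | add x y _ _ hx hy => exact hx.add hy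
    | smul c x _ hx => exact hx.const_smul c
  exact key _ (specialHermite_mem n m)

/-- The Hilbert space `L²(ℝ²; ℂ)`. -/
abbrev L2Plane : Type := Lp ℂ 2 (volume : Measure ℂ)

/-- `φ_{n,m}` as an element of `L²(ℝ²)`. -/
noncomputable def specialHermiteL2 (n m : ℤ) : L2Plane :=
  (memLp_specialHermite n m).toLp (specialHermite n m)

/-- `u` is an `L²`-solution on the time set `I` of the equation `i ∂_t u = 𝓣(u, u, u)`: it is
differentiable in time with values in `L²`, and the equation holds at every time of `I`,
almost everywhere in space. -/
def IsSolutionOn (I : Set ℝ) (u : ℝ → L2Plane) : Prop :=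
  ∀ t ∈ I, ∃ v : L2Plane, HasDerivWithinAt u v I t ∧
    (fun z => Complex.I * v z) =ᵐ[volume] resonantT (u t) (u t) (u t)

/-- `f` is a stationary wave with frequency `ω`: `e^{-i ω t} f` is a solution for all times. -/
def IsStationaryWave (f : L2Plane) (ω : ℝ) : Prop :=
  IsSolutionOn Set.univ fun t => Complex.exp (-(Complex.I * ω * t)) • f

/-- The closed linear span in `L²(ℝ²)` of the `φ_{n,m}` with `(n, m) ∈ S`. -/
noncomputable def hermiteSpan (S : Set (ℤ × ℤ)) : Submodule ℂ L2Plane :=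
  (Submodule.span ℂ ((fun p : ℤ × ℤ => specialHermiteL2 p.1 p.2) '' S)).topologicalClosure

/-- A subspace is dynamically invariant: every solution, on any time interval, which lies in the
subspace at one time lies in it at all times of the interval. -/
def IsDynamicallyInvariant (V : Submodule ℂ L2Plane) : Prop :=
  ∀ (I : Set ℝ) (u : ℝ → L2Plane), I.OrdConnected → IsSolutionOn I u →
    ∀ t₀ ∈ I, u t₀ ∈ V → ∀ t ∈ I, u t ∈ V

end ContinuousResonant

namespace ContinuousResonant

/-! For fixed `λ` substitute `w = (1 + iλ)x + z`. Then `(x + z, iλx + z) = U_λ (w, z)`, where `U_λ`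
is the unitary matrix with diagonal entries `1/(1 + iλ)` and off-diagonal entries `iλ/(1 + iλ)`.
Hence `𝓣(f₁, f₂, f₃)(z)` is the integral against `dλ/(1 + λ²)` of `(f₁ ⊗ f₂) ∘ U_λ` paired with `f₃`
in the variable `w`.

Selection rule. Write `h_{p,q}` for the unnormalized special Hermite functions. Under a unitary
change of two variables the creation operators are mixed linearly, and the product of two Gaussians
is unchanged. So the span of the `h_{i,k}(w) h_{j,l}(z)` with `i + j` and `k + l` prescribed is
preserved (`hermiteFun_mul_unitary_mem`). Pairing an element of it with `h_{p₃,q₃}` leaves, by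
orthogonality, a multiple of a single function, which is `h_{p₄,q₄}` (`exists_partial_pairing`).

The constant. In the variables `(w ± z)/√2` the matrix `U_λ` is `diag(1, ζ)` with `ζ = (1 - iλ)/(1 +
iλ)`, which runs once round the unit circle. As `h_{j,l}(ζv) = ζ^j ζ̄^l h_{j,l}(v)`, the integral
over `λ` keeps only the relative modes with `j = l`, with weight `π`. The quartic integral restricts
both products to `w = z`, where the relative variable is `0`. Now `h_{j,l}(0)` vanishes unless `j =
l`, and `|h_{j,j}(0)|² = j!²` is `‖h_{j,j}‖²/π`. Both sides therefore weigh the same modes in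
proportion, and the ratio is `2π²` (`exists_resonantT_hermiteFun`).

Dynamics. Cauchy-Schwarz in `(λ, x)` bounds `𝓣` on `L²`, with constant `π`. The index sets in
question are stable under `p₁ + p₂ - p₃`, so the selection rule, multilinearity and continuity make
their closed spans stable under `𝓣`. The component of a solution orthogonal to such a span satisfies
a linear differential inequality, hence stays zero once it is zero (`mem_of_hasDerivWithinAt`). -/

/-! ### Wirtinger calculus and the creation operators -/

lemma wirtingerDbar_eq {f : ℂ → ℂ} {L : ℂ →L[ℝ] ℂ} {z : ℂ} (h : HasFDerivAt f L z) :
    wirtingerDbar f z = (1 / 2) * (L 1 + Complex.I * L Complex.I) := by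
  simp only [wirtingerDbar, partialX, partialY, h.fderiv]

lemma wirtingerD_eq {f : ℂ → ℂ} {L : ℂ →L[ℝ] ℂ} {z : ℂ} (h : HasFDerivAt f L z) :
    wirtingerD f z = (1 / 2) * (L 1 - Complex.I * L Complex.I) := by
  simp only [wirtingerD, partialX, partialY, h.fderiv]

lemma map_eq_re_im (L : ℂ →L[ℝ] ℂ) (a : ℂ) : L a = a.re * L 1 + a.im * L Complex.I := by
  have : a = a.re • (1 : ℂ) + a.im • Complex.I := by simp [Complex.re_add_im]
  conv_lhs => rw [this, map_add, map_smul, map_smul]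
  rfl

/-- Chain rule for the holomorphic map `w ↦ a w`: it contributes the factor `ā` to `∂_{z̄}`. The
next lemma gives the factor `a` for `∂_z`. -/
lemma map_wirtingerDbar (L : ℂ →L[ℝ] ℂ) (a : ℂ) :
    L a + Complex.I * L (a * Complex.I) = starRingEnd ℂ a * (L 1 + Complex.I * L Complex.I) := by
  rw [map_eq_re_im L a, map_eq_re_im L (a * Complex.I),
    show starRingEnd ℂ a = a.re - a.im * Complex.I by
      apply Complex.ext <;> simp]
  simp
  linear_combination (a.im * L Complex.I) * Complex.I_sq

lemma map_wirtingerD (L : ℂ →L[ℝ] ℂ) (a : ℂ) :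
    L a - Complex.I * L (a * Complex.I) = a * (L 1 - Complex.I * L Complex.I) := by
  rw [map_eq_re_im L a, map_eq_re_im L (a * Complex.I)]
  have h := Complex.re_add_im a
  simp
  linear_combination (L 1 - Complex.I * L Complex.I) * h + (a.im * L Complex.I) * Complex.I_sq

lemma hasFDerivAt_comp_mul_add {f : ℂ → ℂ} (hf : Differentiable ℝ f) (a b w : ℂ) :
    HasFDerivAt (fun w => f (a * w + b))
      ((fderiv ℝ f (a * w + b)).comp (ContinuousLinearMap.mul ℝ ℂ a)) w :=
  HasFDerivAt.comp (g := f) w (hf _).hasFDerivAt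
    (((ContinuousLinearMap.mul ℝ ℂ a).hasFDerivAt (x := w)).add_const b)

/-- Product and chain rule for `∂_{z̄}`. -/
lemma wirtingerDbar_mul_comp {f g : ℂ → ℂ} (hf : Differentiable ℝ f) (hg : Differentiable ℝ g)
    (a b c d w : ℂ) :
    wirtingerDbar (fun w => f (a * w + b) * g (c * w + d)) w =
      starRingEnd ℂ a * wirtingerDbar f (a * w + b) * g (c * w + d) +
        f (a * w + b) * (starRingEnd ℂ c * wirtingerDbar g (c * w + d)) := by
  rw [wirtingerDbar_eq (f := fun w => f (a * w + b) * g (c * w + d))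
    ((hasFDerivAt_comp_mul_add hf a b w).mul (hasFDerivAt_comp_mul_add hg c d w)),
    wirtingerDbar_eq (hf _).hasFDerivAt,
    wirtingerDbar_eq (hg _).hasFDerivAt]
  have h1 := map_wirtingerDbar (fderiv ℝ f (a * w + b)) a
  have h2 := map_wirtingerDbar (fderiv ℝ g (c * w + d)) c
  simp
  linear_combination (1 / 2 * g (c * w + d)) * h1 + (1 / 2 * f (a * w + b)) * h2

/-- Product and chain rule for `∂_z`. -/
lemma wirtingerD_mul_comp {f g : ℂ → ℂ} (hf : Differentiable ℝ f) (hg : Differentiable ℝ g)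
    (a b c d w : ℂ) :
    wirtingerD (fun w => f (a * w + b) * g (c * w + d)) w =
      a * wirtingerD f (a * w + b) * g (c * w + d) +
        f (a * w + b) * (c * wirtingerD g (c * w + d)) := by
  rw [wirtingerD_eq (f := fun w => f (a * w + b) * g (c * w + d))
    ((hasFDerivAt_comp_mul_add hf a b w).mul (hasFDerivAt_comp_mul_add hg c d w)),
    wirtingerD_eq (hf _).hasFDerivAt,
    wirtingerD_eq (hg _).hasFDerivAt]
  have h1 := map_wirtingerD (fderiv ℝ f (a * w + b)) a
  have h2 := map_wirtingerD (fderiv ℝ g (c * w + d)) c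
  simp
  linear_combination (1 / 2 * g (c * w + d)) * h1 + (1 / 2 * f (a * w + b)) * h2

/-- The chain rule produces `∂_{z̄} f` with the squared norm of the row `(a, b)`, and `∂_{z̄} g`
with the inner product of the two rows. Orthonormality leaves only the first. This is what lets
creation operators be pulled out of a rotated product. -/
lemma creationD_mul_unitary {f g : ℂ → ℂ} (hf : Differentiable ℝ f) (hg : Differentiable ℝ g)
    {a b c d : ℂ} (h1 : a * starRingEnd ℂ a + b * starRingEnd ℂ b = 1)
    (h2 : a * starRingEnd ℂ c + b * starRingEnd ℂ d = 0) (w z : ℂ) :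
    creationD f (a * w + b * z) * g (c * w + d * z) =
      a * creationD (fun w => f (a * w + b * z) * g (c * w + d * z)) w +
        b * creationD (fun z => f (a * w + b * z) * g (c * w + d * z)) z := by
  have e : (fun z => f (a * w + b * z) * g (c * w + d * z)) =
      fun z => f (b * z + a * w) * g (d * z + c * w) := by
    funext z; rw [add_comm (a * w), add_comm (c * w)]
  simp only [e, creationD, wirtingerDbar_mul_comp hf hg]
  rw [add_comm (b * z), add_comm (d * z)]
  linear_combination wirtingerDbar f (a * w + b * z) * g (c * w + d * z) * h1 +
    f (a * w + b * z) * wirtingerDbar g (c * w + d * z) * h2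

lemma creationG_mul_unitary {f g : ℂ → ℂ} (hf : Differentiable ℝ f) (hg : Differentiable ℝ g)
    {a b c d : ℂ} (h1 : a * starRingEnd ℂ a + b * starRingEnd ℂ b = 1)
    (h2 : a * starRingEnd ℂ c + b * starRingEnd ℂ d = 0) (w z : ℂ) :
    creationG f (a * w + b * z) * g (c * w + d * z) =
      starRingEnd ℂ a * creationG (fun w => f (a * w + b * z) * g (c * w + d * z)) w +
        starRingEnd ℂ b * creationG (fun z => f (a * w + b * z) * g (c * w + d * z)) z := by
  have e : (fun z => f (a * w + b * z) * g (c * w + d * z)) =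
      fun z => f (b * z + a * w) * g (d * z + c * w) := by
    funext z; rw [add_comm (a * w), add_comm (c * w)]
  have h2' : starRingEnd ℂ a * c + starRingEnd ℂ b * d = 0 := by
    simpa using congrArg (starRingEnd ℂ) h2
  simp only [e, creationG, wirtingerD_mul_comp hf hg]
  rw [add_comm (b * z), add_comm (d * z)]
  simp only [map_add, map_mul]
  linear_combination wirtingerD f (a * w + b * z) * g (c * w + d * z) * h1 +
    f (a * w + b * z) * wirtingerD g (c * w + d * z) * h2'

lemma creationD_add {f g : ℂ → ℂ} (hf : Differentiable ℝ f) (hg : Differentiable ℝ g) :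
    creationD (f + g) = creationD f + creationD g := by
  funext z
  simp only [creationD, wirtingerDbar, partialX, partialY, Pi.add_apply,
    fderiv_add (hf z) (hg z), add_apply]
  ring

lemma creationG_add {f g : ℂ → ℂ} (hf : Differentiable ℝ f) (hg : Differentiable ℝ g) :
    creationG (f + g) = creationG f + creationG g := by
  funext z
  simp only [creationG, wirtingerD, partialX, partialY, Pi.add_apply,
    fderiv_add (hf z) (hg z), add_apply]
  ring

lemma creationD_smul {f : ℂ → ℂ} (c : ℂ) (hf : Differentiable ℝ f) :
    creationD (c • f) = c • creationD f := by
  funext z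
  simp only [creationD, wirtingerDbar, partialX, partialY, Pi.smul_apply,
    fderiv_const_smul (hf z) c, smul_apply, smul_eq_mul]
  ring

lemma creationG_smul {f : ℂ → ℂ} (c : ℂ) (hf : Differentiable ℝ f) :
    creationG (c • f) = c • creationG f := by
  funext z
  simp only [creationG, wirtingerD, partialX, partialY, Pi.smul_apply,
    fderiv_const_smul (hf z) c, smul_apply, smul_eq_mul]
  ring

lemma creationD_zero : creationD 0 = 0 := by
  funext z; simp [creationD, wirtingerDbar, partialX, partialY]

lemma creationG_zero : creationG 0 = 0 := by
  funext z; simp [creationG, wirtingerD, partialX, partialY]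

lemma creationD_sub {f g : ℂ → ℂ} (hf : Differentiable ℝ f) (hg : Differentiable ℝ g) :
    creationD (f - g) = creationD f - creationD g := by
  have := creationD_add hf (hg.const_smul (-1 : ℂ))
  rw [creationD_smul _ hg] at this
  simpa [sub_eq_add_neg] using this

lemma creationG_sub {f g : ℂ → ℂ} (hf : Differentiable ℝ f) (hg : Differentiable ℝ g) :
    creationG (f - g) = creationG f - creationG g := by
  have := creationG_add hf (hg.const_smul (-1 : ℂ))
  rw [creationG_smul _ hg] at this
  simpa [sub_eq_add_neg] using this

lemma differentiable_monomialGaussian (a b : ℕ) : Differentiable ℝ (monomialGaussian a b) :=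
  differentiable_of_mem (monomialGaussian_mem a b)

lemma creationD_creationG_monomialGaussian (a b : ℕ) :
    creationD (creationG (monomialGaussian a b)) = creationG (creationD (monomialGaussian a b)) := by
  have hd := differentiable_monomialGaussian
  rw [creationG_monomialGaussian, creationD_monomialGaussian,
    creationD_sub (hd _ _) ((hd _ _).const_smul _), creationG_sub (hd _ _) ((hd _ _).const_smul _),
    creationD_smul _ (hd _ _), creationG_smul _ (hd _ _)]
  simp only [creationG_monomialGaussian, creationD_monomialGaussian]
  -- The exponents `a - 1` and `b - 1` are truncated, so the zero cases are treated apart.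
  rcases a with _ | a <;> rcases b with _ | b <;> simp <;> module

lemma creationD_creationG_comm {f : ℂ → ℂ} (hf : f ∈ polyGaussian) :
    creationD (creationG f) = creationG (creationD f) := by
  induction hf using Submodule.span_induction with
  | mem x h => obtain ⟨p, rfl⟩ := h; exact creationD_creationG_monomialGaussian _ _
  | zero => rw [creationG_zero, creationD_zero, creationG_zero]
  | add x y h1 h2 hx hy =>
    rw [creationG_add (differentiable_of_mem h1) (differentiable_of_mem h2),
      creationD_add (differentiable_of_mem h1) (differentiable_of_mem h2),
      creationD_add (differentiable_of_mem (creationG_mem h1))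
        (differentiable_of_mem (creationG_mem h2)),
      creationG_add (differentiable_of_mem (creationD_mem h1))
        (differentiable_of_mem (creationD_mem h2)), hx, hy]
  | smul c x h1 hx =>
    rw [creationG_smul _ (differentiable_of_mem h1), creationD_smul _ (differentiable_of_mem h1),
      creationD_smul _ (differentiable_of_mem (creationG_mem h1)),
      creationG_smul _ (differentiable_of_mem (creationD_mem h1)), hx]

/-! ### The functions `h_{p,q}`: recurrence, rotation, conjugation, value at the origin -/

/-- The unnormalized special Hermite functions `(a_d^*)^p (a_g^*)^q exp (- z z̄ / 2)`. -/
noncomputable def hermiteFun (p q : ℕ) : ℂ → ℂ := creationD^[p] (creationG^[q] gaussian)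

lemma gaussian_eq_monomialGaussian : gaussian = monomialGaussian 0 0 := by
  funext z; simp [monomialGaussian]

lemma hermiteFun_zero_zero : hermiteFun 0 0 = gaussian := rfl

lemma creationD_hermiteFun (p q : ℕ) : creationD (hermiteFun p q) = hermiteFun (p + 1) q := by
  rw [hermiteFun, hermiteFun, Function.iterate_succ_apply']

lemma hermiteFun_mem (p q : ℕ) : hermiteFun p q ∈ polyGaussian := by
  induction p with
  | succ p ih => rw [← creationD_hermiteFun]; exact creationD_mem ih
  | zero =>
    induction q with
    | zero =>
      rw [hermiteFun_zero_zero, gaussian_eq_monomialGaussian]; exact monomialGaussian_mem 0 0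
    | succ q ih =>
      have : hermiteFun 0 (q + 1) = creationG (hermiteFun 0 q) := by
        simp [hermiteFun, Function.iterate_succ_apply']
      rw [this]; exact creationG_mem ih

lemma creationG_hermiteFun (p q : ℕ) : creationG (hermiteFun p q) = hermiteFun p (q + 1) := by
  induction p with
  | zero => simp [hermiteFun, Function.iterate_succ_apply']
  | succ p ih =>
    rw [← creationD_hermiteFun, ← creationD_creationG_comm (hermiteFun_mem p q), ih,
      creationD_hermiteFun]

lemma differentiable_hermiteFun (p q : ℕ) : Differentiable ℝ (hermiteFun p q) :=
  differentiable_of_mem (hermiteFun_mem p q)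

lemma hermiteFun_zero_left (q : ℕ) : hermiteFun 0 q = monomialGaussian 0 q := by
  induction q with
  | zero => exact gaussian_eq_monomialGaussian
  | succ q ih => rw [← creationG_hermiteFun, ih, creationG_monomialGaussian]; simp

lemma hermiteFun_zero_right (p : ℕ) : hermiteFun p 0 = monomialGaussian p 0 := by
  induction p with
  | zero => exact gaussian_eq_monomialGaussian
  | succ p ih => rw [← creationD_hermiteFun, ih, creationD_monomialGaussian]; simp

lemma wirtingerD_id_mul {f : ℂ → ℂ} (hf : Differentiable ℝ f) (z : ℂ) :
    wirtingerD (fun z => z * f z) z = f z + z * wirtingerD f z := by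
  rw [wirtingerD_eq (f := fun z => z * f z) ((hasFDerivAt_id z).mul (hf z).hasFDerivAt),
    wirtingerD_eq (hf z).hasFDerivAt]
  simp
  linear_combination (-(1 / 2) * f z) * Complex.I_sq

/-- The commutator of `a_g^*` with multiplication by `z` is `-1`; it drives the induction on `q` in
`id_mul_hermiteFun`. -/
lemma creationG_id_mul {f : ℂ → ℂ} (hf : Differentiable ℝ f) :
    creationG (fun z => z * f z) = (fun z => z * creationG f z) - f := by
  funext z
  simp only [creationG, wirtingerD_id_mul hf, Pi.sub_apply]
  ring

/-- The recurrence `z h_{p,q} = h_{p+1,q} + q h_{p,q-1}`. -/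
lemma id_mul_hermiteFun (p q : ℕ) :
    (fun z => z * hermiteFun p q z) = hermiteFun (p + 1) q + (q : ℂ) • hermiteFun p (q - 1) := by
  induction q with
  | zero =>
    funext z
    simp [hermiteFun_zero_right, monomialGaussian]
    ring
  | succ q ih =>
    have h := creationG_id_mul (differentiable_hermiteFun p q)
    rw [ih, creationG_add (differentiable_hermiteFun _ _)
      ((differentiable_hermiteFun _ _).const_smul _),
      creationG_smul _ (differentiable_hermiteFun _ _)] at h
    simp only [creationG_hermiteFun] at h
    rw [eq_sub_iff_add_eq] at h
    rw [← h]
    rcases q with _ | q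
    · simp
    · simp only [Nat.add_sub_cancel]; push_cast; module

lemma hermiteFun_succ (p q : ℕ) (z : ℂ) :
    hermiteFun (p + 1) q z = z * hermiteFun p q z - q * hermiteFun p (q - 1) z := by
  have := congrFun (id_mul_hermiteFun p q) z
  simp at this
  rw [this]; ring

lemma gaussian_rotate {u : ℂ} (hu : u * starRingEnd ℂ u = 1) (z : ℂ) :
    gaussian (u * z) = gaussian z := by
  simp only [gaussian, map_mul]
  congr 2
  linear_combination (-(z * starRingEnd ℂ z)) * hu

/-- Both terms of the recurrence `h_{p+1,q} = z h_{p,q} - q h_{p,q-1}` have the same weight, because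
`u ū = 1` makes `u^p ū^(q-1)` equal to `u^(p+1) ū^q`. -/
lemma hermiteFun_rotate {u : ℂ} (hu : u * starRingEnd ℂ u = 1) (p q : ℕ) (z : ℂ) :
    hermiteFun p q (u * z) = u ^ p * (starRingEnd ℂ u) ^ q * hermiteFun p q z := by
  induction p generalizing q with
  | zero =>
    simp only [hermiteFun_zero_left, monomialGaussian, gaussian_rotate hu, map_mul]
    ring
  | succ p ih =>
    rw [hermiteFun_succ, hermiteFun_succ, ih, ih]
    rcases q with _ | q
    · simp; ring
    · simp
      have : u ^ p * starRingEnd ℂ u ^ q = u ^ (p + 1) * starRingEnd ℂ u ^ (q + 1) := by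
        linear_combination (-u ^ p * starRingEnd ℂ u ^ q) * hu
      rw [this]; ring

lemma conj_gaussian (z : ℂ) : starRingEnd ℂ (gaussian z) = gaussian z := by
  have h2 : starRingEnd ℂ 2 = 2 := map_ofNat _ 2
  simp [gaussian, ← Complex.exp_conj, mul_comm, h2]

lemma wirtingerD_conj {f : ℂ → ℂ} (hf : Differentiable ℝ f) (z : ℂ) :
    wirtingerD (fun z => starRingEnd ℂ (f z)) z = starRingEnd ℂ (wirtingerDbar f z) := by
  have h : HasFDerivAt (fun z => starRingEnd ℂ (f z))
      ((Complex.conjCLE : ℂ →L[ℝ] ℂ).comp (fderiv ℝ f z)) z :=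
    HasFDerivAt.comp (g := starRingEnd ℂ) z (Complex.conjCLE : ℂ →L[ℝ] ℂ).hasFDerivAt
      (hf z).hasFDerivAt
  have h2 : starRingEnd ℂ 2 = 2 := map_ofNat _ 2
  rw [wirtingerD_eq h, wirtingerDbar_eq (hf z).hasFDerivAt]
  simp [h2]
  ring

lemma creationG_conj {f : ℂ → ℂ} (hf : Differentiable ℝ f) :
    creationG (fun z => starRingEnd ℂ (f z)) = fun z => starRingEnd ℂ (creationD f z) := by
  funext z
  have h2 : starRingEnd ℂ 2 = 2 := map_ofNat _ 2
  simp [creationG, creationD, wirtingerD_conj hf, h2]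

/-- Conjugation exchanges the two creation operators and fixes the Gaussian. -/
lemma conj_hermiteFun (p q : ℕ) (z : ℂ) :
    starRingEnd ℂ (hermiteFun p q z) = hermiteFun q p z := by
  revert z
  rw [← funext_iff (f := fun z => starRingEnd ℂ (hermiteFun p q z))]
  induction p with
  | zero =>
    funext z
    simp [hermiteFun_zero_left, hermiteFun_zero_right, monomialGaussian, conj_gaussian]
  | succ p ih =>
    rw [← creationG_hermiteFun, ← ih, creationG_conj (differentiable_hermiteFun _ _),
      creationD_hermiteFun]

lemma hermiteFun_apply_zero_succ (p q : ℕ) :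
    hermiteFun (p + 1) (q + 1) 0 = -(q + 1) * hermiteFun p q 0 := by
  rw [hermiteFun_succ]; push_cast; simp; ring

lemma hermiteFun_diag_apply_zero (j : ℕ) : hermiteFun j j 0 = (-1) ^ j * j.factorial := by
  induction j with
  | zero => simp [hermiteFun_zero_zero, gaussian]
  | succ j ih => rw [hermiteFun_apply_zero_succ, ih, Nat.factorial_succ]; push_cast; ring

lemma hermiteFun_apply_zero_of_ne {p q : ℕ} (h : p ≠ q) : hermiteFun p q 0 = 0 := by
  induction p generalizing q with
  | zero => simp [hermiteFun_zero_left, monomialGaussian, h.symm]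
  | succ p ih =>
    rcases q with _ | q
    · simp [hermiteFun_zero_right, monomialGaussian]
    · rw [hermiteFun_apply_zero_succ, ih (by omega), mul_zero]

/-! ### Two-particle spaces and their unitary invariance -/

/-- The span of the products `h_{i,k}(w) h_{j,l}(z)` with `i + j = N` and `k + l = M`. -/
noncomputable def twoParticle (N M : ℕ) : Submodule ℂ (ℂ → ℂ → ℂ) :=
  Submodule.span ℂ (Set.range fun (jl : Fin (N + 1) × Fin (M + 1)) (w z : ℂ) =>
    hermiteFun (N - jl.1) (M - jl.2) w * hermiteFun jl.1 jl.2 z)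

lemma mul_hermiteFun_mem (i j k l : ℕ) :
    (fun w z => hermiteFun i k w * hermiteFun j l z) ∈ twoParticle (i + j) (k + l) := by
  refine Submodule.subset_span ⟨(⟨j, by omega⟩, ⟨l, by omega⟩), ?_⟩
  simp

/-- An induction principle: elements of `twoParticle` are built from products. -/
lemma twoParticle_induction {N M : ℕ} {P : (ℂ → ℂ → ℂ) → Prop}
    (mem : ∀ i j k l, i + j = N → k + l = M → P fun w z => hermiteFun i k w * hermiteFun j l z)
    (zero : P 0) (add : ∀ x ∈ twoParticle N M, ∀ y ∈ twoParticle N M, P x → P y → P (x + y))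
    (smul : ∀ c : ℂ, ∀ x ∈ twoParticle N M, P x → P (c • x)) {Y : ℂ → ℂ → ℂ}
    (hY : Y ∈ twoParticle N M) : P Y := by
  induction hY using Submodule.span_induction with
  | mem x h => obtain ⟨⟨j, l⟩, rfl⟩ := h; exact mem _ _ _ _ (by simp; omega) (by simp; omega)
  | zero => exact zero
  | add x y hx hy h1 h2 => exact add x hx y hy h1 h2
  | smul c x hx h1 => exact smul c x hx h1

lemma differentiable_twoParticle {N M : ℕ} {Y : ℂ → ℂ → ℂ} (hY : Y ∈ twoParticle N M) :
    (∀ z, Differentiable ℝ fun w => Y w z) ∧ ∀ w, Differentiable ℝ (Y w) := by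
  refine twoParticle_induction (P := fun Y => (∀ z, Differentiable ℝ fun w => Y w z) ∧
    ∀ w, Differentiable ℝ (Y w)) ?_ ?_ ?_ ?_ hY
  · intro i j k l _ _
    exact ⟨fun z => (differentiable_hermiteFun _ _).mul_const _,
      fun w => (differentiable_hermiteFun _ _).const_mul _⟩
  · exact ⟨fun z => differentiable_const 0, fun w => differentiable_const 0⟩
  · intro x _ y _ hx hy
    exact ⟨fun z => (hx.1 z).add (hy.1 z), fun w => (hx.2 w).add (hy.2 w)⟩
  · intro c x _ hx
    exact ⟨fun z => (hx.1 z).const_smul c, fun w => (hx.2 w).const_smul c⟩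

/-- Reduces to products the claim that an operator acting in the first variable maps one
two-particle space into another. Linearity is required only on differentiable functions, since the
creation operators are built on `fderiv`. -/
lemma fst_mem_twoParticle {A : (ℂ → ℂ) → ℂ → ℂ} {N M N' M' : ℕ} {Y : ℂ → ℂ → ℂ}
    (h0 : A 0 = 0) (hadd : ∀ f g, Differentiable ℝ f → Differentiable ℝ g → A (f + g) = A f + A g)
    (hsmul : ∀ (c : ℂ) f, Differentiable ℝ f → A (c • f) = c • A f)
    (hmem : ∀ i j k l, i + j = N → k + l = M →
      (fun w z => A (hermiteFun i k) w * hermiteFun j l z) ∈ twoParticle N' M')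
    (hY : Y ∈ twoParticle N M) : (fun w z => A (fun w => Y w z) w) ∈ twoParticle N' M' := by
  refine twoParticle_induction
    (P := fun Y => (fun w z => A (fun w => Y w z) w) ∈ twoParticle N' M') ?_ ?_ ?_ ?_ hY
  · intro i j k l hN hM
    convert hmem i j k l hN hM using 3 with w z
    have := hsmul (hermiteFun j l z) (hermiteFun i k) (differentiable_hermiteFun _ _)
    have e : (fun w => hermiteFun i k w * hermiteFun j l z) =
      hermiteFun j l z • hermiteFun i k := by funext w; simp [mul_comm]
    rw [e, this]; simp [mul_comm]
  · convert zero_mem (twoParticle N' M') using 3 with w z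
    exact congrFun h0 w
  · intro x hx y hy h1 h2
    convert add_mem h1 h2 using 3 with w z
    exact congrFun (hadd _ _ ((differentiable_twoParticle hx).1 z)
      ((differentiable_twoParticle hy).1 z)) w
  · intro c x hx h1
    convert Submodule.smul_mem _ c h1 using 3 with w z
    exact congrFun (hsmul c _ ((differentiable_twoParticle hx).1 z)) w

lemma swap_mem_twoParticle {N M : ℕ} {Y : ℂ → ℂ → ℂ} (hY : Y ∈ twoParticle N M) :
    (fun w z => Y z w) ∈ twoParticle N M := by
  refine twoParticle_induction (P := fun Y => (fun w z => Y z w) ∈ twoParticle N M)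
    ?_ ?_ ?_ ?_ hY
  · rintro i j k l rfl rfl
    rw [add_comm i, add_comm k]
    convert mul_hermiteFun_mem j i l k using 3
    exact mul_comm _ _
  · exact zero_mem _
  · intro x _ y _ h1 h2; exact add_mem h1 h2
  · intro c x _ h1; exact Submodule.smul_mem _ c h1

lemma creationD_fst_mem {N M : ℕ} {Y : ℂ → ℂ → ℂ} (hY : Y ∈ twoParticle N M) :
    (fun w z => creationD (fun w => Y w z) w) ∈ twoParticle (N + 1) M := by
  refine fst_mem_twoParticle creationD_zero (fun f g => creationD_add)
    (fun c f => creationD_smul c) ?_ hY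
  rintro i j k l rfl rfl
  rw [creationD_hermiteFun, Nat.add_right_comm]
  exact mul_hermiteFun_mem _ _ _ _

lemma creationG_fst_mem {N M : ℕ} {Y : ℂ → ℂ → ℂ} (hY : Y ∈ twoParticle N M) :
    (fun w z => creationG (fun w => Y w z) w) ∈ twoParticle N (M + 1) := by
  refine fst_mem_twoParticle creationG_zero (fun f g => creationG_add)
    (fun c f => creationG_smul c) ?_ hY
  rintro i j k l rfl rfl
  rw [creationG_hermiteFun, Nat.add_right_comm k l]
  exact mul_hermiteFun_mem _ _ _ _

lemma creationD_snd_mem {N M : ℕ} {Y : ℂ → ℂ → ℂ} (hY : Y ∈ twoParticle N M) :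
    (fun w z => creationD (Y w) z) ∈ twoParticle (N + 1) M :=
  swap_mem_twoParticle (creationD_fst_mem (swap_mem_twoParticle hY))

lemma creationG_snd_mem {N M : ℕ} {Y : ℂ → ℂ → ℂ} (hY : Y ∈ twoParticle N M) :
    (fun w z => creationG (Y w) z) ∈ twoParticle N (M + 1) :=
  swap_mem_twoParticle (creationG_fst_mem (swap_mem_twoParticle hY))

/-- The two-particle spaces are invariant under unitary changes of variables. -/
lemma hermiteFun_mul_unitary_mem {a b c d : ℂ}
    (h1 : a * starRingEnd ℂ a + b * starRingEnd ℂ b = 1)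
    (h2 : a * starRingEnd ℂ c + b * starRingEnd ℂ d = 0)
    (h3 : c * starRingEnd ℂ c + d * starRingEnd ℂ d = 1)
    (h4 : a * starRingEnd ℂ a + c * starRingEnd ℂ c = 1)
    (h5 : b * starRingEnd ℂ b + d * starRingEnd ℂ d = 1)
    (h6 : a * starRingEnd ℂ b + c * starRingEnd ℂ d = 0) (p₁ q₁ p₂ q₂ : ℕ) :
    (fun w z => hermiteFun p₁ q₁ (a * w + b * z) * hermiteFun p₂ q₂ (c * w + d * z)) ∈
      twoParticle (p₁ + p₂) (q₁ + q₂) := by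
  have h2' : c * starRingEnd ℂ a + d * starRingEnd ℂ b = 0 := by
    simpa [mul_comm] using congrArg (starRingEnd ℂ) h2
  have h6' : b * starRingEnd ℂ a + d * starRingEnd ℂ c = 0 := by
    simpa [mul_comm] using congrArg (starRingEnd ℂ) h6
  have hd := differentiable_hermiteFun
  induction p₁ with
  | succ p₁ ih =>
    -- Each induction peels off one creation operator and turns it into a combination of creation
    -- operators in `w` and in `z`, which raise the total degree by one.
    simp_rw [← creationD_hermiteFun p₁, creationD_mul_unitary (hd _ _) (hd _ _) h1 h2]
    rw [Nat.add_right_comm]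
    exact add_mem (Submodule.smul_mem _ a (creationD_fst_mem ih))
      (Submodule.smul_mem _ b (creationD_snd_mem ih))
  | zero =>
  induction q₁ with
  | succ q₁ ih =>
    simp_rw [← creationG_hermiteFun _ q₁, creationG_mul_unitary (hd _ _) (hd _ _) h1 h2]
    rw [Nat.add_right_comm q₁]
    exact add_mem (Submodule.smul_mem _ (starRingEnd ℂ a) (creationG_fst_mem ih))
      (Submodule.smul_mem _ (starRingEnd ℂ b) (creationG_snd_mem ih))
  | zero =>
  induction p₂ with
  | succ p₂ ih =>
    -- The second factor is treated like the first, with the two rows of the matrix exchanged.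
    simp_rw [mul_comm (hermiteFun 0 0 _)] at ih ⊢
    simp_rw [← creationD_hermiteFun p₂, creationD_mul_unitary (hd _ _) (hd _ _) h3 h2']
    exact add_mem (Submodule.smul_mem _ c (creationD_fst_mem ih))
      (Submodule.smul_mem _ d (creationD_snd_mem ih))
  | zero =>
  induction q₂ with
  | succ q₂ ih =>
    simp_rw [mul_comm (hermiteFun 0 0 _)] at ih ⊢
    simp_rw [← creationG_hermiteFun _ q₂, creationG_mul_unitary (hd _ _) (hd _ _) h3 h2']
    exact add_mem (Submodule.smul_mem _ (starRingEnd ℂ c) (creationG_fst_mem ih))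
      (Submodule.smul_mem _ (starRingEnd ℂ d) (creationG_snd_mem ih))
  | zero =>
    -- The product of two Gaussians depends only on `|w|² + |z|²`, which is preserved because the
    -- columns are orthonormal.
    convert mul_hermiteFun_mem 0 0 0 0 using 3 with w z
    simp only [hermiteFun_zero_zero, gaussian, ← Complex.exp_add, map_add, map_mul]
    congr 1
    linear_combination (-(w * starRingEnd ℂ w) / 2) * h4 + (-(z * starRingEnd ℂ z) / 2) * h5 +
      (-(w * starRingEnd ℂ z) / 2) * h6 + (-(z * starRingEnd ℂ w) / 2) * h6'

/-! ### Integration by parts and orthogonality -/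

lemma memLp_of_mem {f : ℂ → ℂ} (hf : f ∈ polyGaussian) : MemLp f 2 (volume : Measure ℂ) := by
  induction hf using Submodule.span_induction with
  | mem x h => obtain ⟨p, rfl⟩ := h; exact memLp_monomialGaussian p.1 p.2
  | zero => exact MemLp.zero
  | add x y _ _ hx hy => exact hx.add hy
  | smul c x _ hx => exact hx.const_smul c

lemma integrable_mul_of_mem {f g : ℂ → ℂ} (hf : f ∈ polyGaussian) (hg : g ∈ polyGaussian) :
    Integrable fun z => f z * g z :=
  (memLp_of_mem hf).integrable_mul (memLp_of_mem hg)

lemma id_mul_mem {f : ℂ → ℂ} (hf : f ∈ polyGaussian) : (fun z => z * f z) ∈ polyGaussian := by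
  induction hf using Submodule.span_induction with
  | mem x h =>
    obtain ⟨p, rfl⟩ := h
    convert monomialGaussian_mem (p.1 + 1) p.2 using 2 with z
    simp only [monomialGaussian]; ring
  | zero => convert zero_mem polyGaussian; simp
  | add x y _ _ hx hy => convert add_mem hx hy using 2 with z; simp [mul_add]
  | smul c x _ hx => convert Submodule.smul_mem _ c hx using 2 with z; simp; ring

lemma conj_mul_mem {f : ℂ → ℂ} (hf : f ∈ polyGaussian) :
    (fun z => starRingEnd ℂ z * f z) ∈ polyGaussian := by
  induction hf using Submodule.span_induction with
  | mem x h =>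
    obtain ⟨p, rfl⟩ := h
    convert monomialGaussian_mem p.1 (p.2 + 1) using 2 with z
    simp only [monomialGaussian]; ring
  | zero => convert zero_mem polyGaussian; simp
  | add x y _ _ hx hy => convert add_mem hx hy using 2 with z; simp [mul_add]
  | smul c x _ hx => convert Submodule.smul_mem _ c hx using 2 with z; simp; ring

lemma wirtingerDbar_mem {f : ℂ → ℂ} (hf : f ∈ polyGaussian) : wirtingerDbar f ∈ polyGaussian := by
  convert sub_mem (Submodule.smul_mem _ (1 / 2 : ℂ) (id_mul_mem hf)) (creationD_mem hf) using 1
  funext z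
  simp [creationD]; ring

lemma wirtingerD_mem {f : ℂ → ℂ} (hf : f ∈ polyGaussian) : wirtingerD f ∈ polyGaussian := by
  convert sub_mem (Submodule.smul_mem _ (1 / 2 : ℂ) (conj_mul_mem hf)) (creationG_mem hf) using 1
  funext z
  simp [creationG]; ring

lemma partialX_mem {f : ℂ → ℂ} (hf : f ∈ polyGaussian) : partialX f ∈ polyGaussian := by
  convert add_mem (wirtingerD_mem hf) (wirtingerDbar_mem hf) using 1
  funext z
  simp [wirtingerD, wirtingerDbar]; ring

lemma partialY_mem {f : ℂ → ℂ} (hf : f ∈ polyGaussian) : partialY f ∈ polyGaussian := by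
  convert Submodule.smul_mem _ Complex.I (sub_mem (wirtingerD_mem hf) (wirtingerDbar_mem hf))
    using 1
  funext z
  simp [wirtingerD, wirtingerDbar]
  linear_combination (partialY f z) * Complex.I_sq

lemma integral_mul_wirtingerDbar {f g : ℂ → ℂ} (hf : f ∈ polyGaussian) (hg : g ∈ polyGaussian) :
    ∫ z, f z * wirtingerDbar g z = -∫ z, wirtingerDbar f z * g z := by
  have h1 : ∫ z, f z * partialX g z = -∫ z, partialX f z * g z :=
    integral_mul_fderiv_eq_neg_fderiv_mul_of_integrable
      (integrable_mul_of_mem (partialX_mem hf) hg) (integrable_mul_of_mem hf (partialX_mem hg))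
      (integrable_mul_of_mem hf hg) (fun z _ => differentiable_of_mem hf z)
      (fun z _ => differentiable_of_mem hg z)
  have h2 : ∫ z, f z * partialY g z = -∫ z, partialY f z * g z :=
    integral_mul_fderiv_eq_neg_fderiv_mul_of_integrable
      (integrable_mul_of_mem (partialY_mem hf) hg) (integrable_mul_of_mem hf (partialY_mem hg))
      (integrable_mul_of_mem hf hg) (fun z _ => differentiable_of_mem hf z)
      (fun z _ => differentiable_of_mem hg z)
  have e1 : ∫ z, f z * wirtingerDbar g z =
      (1 / 2) * ((∫ z, f z * partialX g z) + Complex.I * ∫ z, f z * partialY g z) := by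
    rw [← integral_const_mul, ← integral_add (integrable_mul_of_mem hf (partialX_mem hg))
      ((integrable_mul_of_mem hf (partialY_mem hg)).const_mul _), ← integral_const_mul]
    congr 1; funext z; simp only [wirtingerDbar]; ring
  have e2 : ∫ z, wirtingerDbar f z * g z =
      (1 / 2) * ((∫ z, partialX f z * g z) + Complex.I * ∫ z, partialY f z * g z) := by
    rw [← integral_const_mul, ← integral_add (integrable_mul_of_mem (partialX_mem hf) hg)
      ((integrable_mul_of_mem (partialY_mem hf) hg).const_mul _), ← integral_const_mul]
    congr 1; funext z; simp only [wirtingerDbar]; ring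
  rw [e1, e2, h1, h2]; ring

/-- For the bilinear pairing, without conjugation, integration by parts shows that the transpose of
`a_d^*` is `(z + 2∂_{z̄})/2 = z - a_d^*`. -/
lemma integral_creationD_mul {f g : ℂ → ℂ} (hf : f ∈ polyGaussian) (hg : g ∈ polyGaussian) :
    ∫ z, creationD f z * g z = ∫ z, f z * (z * g z - creationD g z) := by
  have h := integral_mul_wirtingerDbar hf hg
  have i1 := integrable_mul_of_mem (Submodule.smul_mem _ (1 / 2 : ℂ) (id_mul_mem hf)) hg
  have e1 : ∫ z, creationD f z * g z = (∫ z, ((1 / 2 : ℂ) • fun z => z * f z) z * g z) -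
      ∫ z, wirtingerDbar f z * g z := by
    rw [← integral_sub i1 (integrable_mul_of_mem (wirtingerDbar_mem hf) hg)]
    congr 1; funext z; simp [creationD]; ring
  have e2 : ∫ z, f z * (z * g z - creationD g z) =
      (∫ z, ((1 / 2 : ℂ) • fun z => z * f z) z * g z) + ∫ z, f z * wirtingerDbar g z := by
    rw [← integral_add i1 (integrable_mul_of_mem hf (wirtingerDbar_mem hg))]
    congr 1; funext z; simp [creationD]; ring
  rw [e1, e2, h]; ring

/-- The transpose `z - a_d^*` is a lowering operator: by the recurrence it sends `h_{a,b}` to `b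
h_{a,b-1}`. Iteration gives all the orthogonality relations. -/
lemma integral_hermiteFun_succ_mul (p q a b : ℕ) :
    ∫ z, hermiteFun (p + 1) q z * hermiteFun a b z =
      b * ∫ z, hermiteFun p q z * hermiteFun a (b - 1) z := by
  rw [← creationD_hermiteFun, integral_creationD_mul (hermiteFun_mem _ _) (hermiteFun_mem _ _),
    ← integral_const_mul]
  congr 1; funext z
  rw [creationD_hermiteFun, hermiteFun_succ]; ring

lemma integral_hermiteFun_mul_conj (p q a b : ℕ) :
    ∫ z, hermiteFun p q z * hermiteFun a b z =
      starRingEnd ℂ (∫ z, hermiteFun q p z * hermiteFun b a z) := by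
  rw [← integral_conj]
  simp [conj_hermiteFun]

lemma integral_gaussian_sq : ∫ z, gaussian z * gaussian z = Real.pi := by
  have h := GaussianFourier.integral_rexp_neg_mul_sq_norm (V := ℂ) (b := 1) one_pos
  have e : ∀ z : ℂ, gaussian z * gaussian z = ((Real.exp (-1 * ‖z‖ ^ 2) : ℝ) : ℂ) := fun z => by
    rw [gaussian, ← Complex.exp_add, Complex.ofReal_exp, Complex.mul_conj,
      Complex.normSq_eq_norm_sq]
    congr 1; push_cast; ring
  simp_rw [e, integral_complex_ofReal, h]
  simp

/-- Orthogonality: `∫ h_{p,q} h_{a,b} = π p! q!` if `(a, b) = (q, p)`, and `0` otherwise. -/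
lemma integral_hermiteFun_mul (p q a b : ℕ) :
    ∫ z, hermiteFun p q z * hermiteFun a b z =
      if p = b ∧ q = a then (Real.pi : ℂ) * p.factorial * q.factorial else 0 := by
  induction p generalizing b with
  | succ p ih =>
    rw [integral_hermiteFun_succ_mul, ih]
    rcases b with _ | b
    · simp
    · simp only [Nat.add_sub_cancel, Nat.add_right_cancel_iff]
      split_ifs with h
      · rw [Nat.factorial_succ, h.1]; push_cast; ring
      · simp
  | zero =>
  rcases b with _ | b
  · induction q generalizing a with
    | zero =>
      rcases a with _ | a
      · simpa [hermiteFun_zero_zero] using integral_gaussian_sq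
      · simp_rw [mul_comm (hermiteFun 0 0 _)]
        rw [integral_hermiteFun_succ_mul]; simp
    | succ q ih =>
      -- Conjugation turns lowering in the index `p` into lowering in the index `q`.
      rw [integral_hermiteFun_mul_conj, integral_hermiteFun_succ_mul, map_mul,
        ← integral_hermiteFun_mul_conj, ih]
      rcases a with _ | a
      · simp
      · simp only [Nat.add_sub_cancel, Nat.add_right_cancel_iff]
        split_ifs with h
        · rw [Nat.factorial_succ, h.2]; push_cast; simp; ring
        · simp
  · rw [integral_hermiteFun_mul_conj]
    simp_rw [mul_comm (hermiteFun q 0 _)]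
    rw [integral_hermiteFun_succ_mul]; simp

lemma integral_hermiteFun_mul_conj_hermiteFun (p q a b : ℕ) :
    ∫ z, hermiteFun p q z * starRingEnd ℂ (hermiteFun a b z) =
      if p = a ∧ q = b then (Real.pi : ℂ) * p.factorial * q.factorial else 0 := by
  simp_rw [conj_hermiteFun]
  exact integral_hermiteFun_mul p q b a

/-! ### The inner integral as a unitary substitution -/

/-- Scaling by a complex number multiplies the area by its squared modulus. -/
lemma map_mul_left_volume {a : ℂ} (ha : a ≠ 0) :
    Measure.map (fun w : ℂ => a * w) volume =
      ENNReal.ofReal (Complex.normSq a)⁻¹ • (volume : Measure ℂ) := by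
  have hd : LinearMap.det (LinearMap.mulLeft ℝ a) = Complex.normSq a := by
    rw [← Algebra.norm_complex_apply, Algebra.norm_apply]; rfl
  have hn : Complex.normSq a ≠ 0 := by simpa using ha
  have := Measure.map_linearMap_addHaar_eq_smul_addHaar (volume : Measure ℂ)
    (f := LinearMap.mulLeft ℝ a) (by rwa [hd])
  rw [hd, abs_of_nonneg (by simpa using Complex.normSq_nonneg a)] at this
  exact this

lemma measurableEmbedding_mul_add {a : ℂ} (ha : a ≠ 0) (b : ℂ) :
    MeasurableEmbedding fun w : ℂ => a * w + b :=
  ((Homeomorph.mulLeft₀ a ha).trans (Homeomorph.addRight b)).measurableEmbedding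

lemma map_mul_add_volume {a : ℂ} (ha : a ≠ 0) (b : ℂ) :
    Measure.map (fun w : ℂ => a * w + b) volume =
      ENNReal.ofReal (Complex.normSq a)⁻¹ • (volume : Measure ℂ) := by
  have : (fun w : ℂ => a * w + b) = (fun w => w + b) ∘ fun w => a * w := rfl
  rw [this, ← Measure.map_map (by fun_prop) (by fun_prop), map_mul_left_volume ha,
    Measure.map_smul, map_add_right_eq_self]

lemma integral_comp_mul_add {a : ℂ} (ha : a ≠ 0) (b : ℂ) (f : ℂ → ℂ) :
    ∫ w, f (a * w + b) = ((Complex.normSq a)⁻¹ : ℝ) * ∫ w, f w := by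
  rw [← (measurableEmbedding_mul_add ha b).integral_map, map_mul_add_volume ha,
    integral_smul_measure, ENNReal.toReal_ofReal (by simpa using Complex.normSq_nonneg a),
    Complex.real_smul]

lemma lintegral_comp_mul_add {a : ℂ} (ha : a ≠ 0) (b : ℂ) (f : ℂ → ENNReal) :
    ∫⁻ w, f (a * w + b) = ENNReal.ofReal (Complex.normSq a)⁻¹ * ∫⁻ w, f w := by
  rw [← (measurableEmbedding_mul_add ha b).lintegral_map, map_mul_add_volume ha,
    lintegral_smul_measure, smul_eq_mul]

lemma one_add_mul_I_ne_zero (l : ℝ) : (1 + l * Complex.I : ℂ) ≠ 0 := fun h => by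
  have := congrArg Complex.re h
  simp at this

lemma one_sub_mul_I_ne_zero (l : ℝ) : (1 - l * Complex.I : ℂ) ≠ 0 := fun h => by
  have := congrArg Complex.re h
  simp at this

lemma normSq_one_add_mul_I (l : ℝ) : Complex.normSq (1 + l * Complex.I) = 1 + l ^ 2 := by
  simp [Complex.normSq_apply]; ring

/-- The substitution `w = (1 + i λ) x + z` in the inner integral of the trilinear operator. -/
lemma integral_resonantIntegrand (f₁ f₂ f₃ : ℂ → ℂ) (z : ℂ) (l : ℝ) :
    ∫ x, resonantIntegrand f₁ f₂ f₃ z l x = ((1 + l ^ 2)⁻¹ : ℝ) *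
      ∫ w, f₁ ((1 + l * Complex.I)⁻¹ * w + (l * Complex.I * (1 + l * Complex.I)⁻¹) * z) *
        f₂ ((l * Complex.I * (1 + l * Complex.I)⁻¹) * w + (1 + l * Complex.I)⁻¹ * z) *
        starRingEnd ℂ (f₃ w) := by
  have h := one_add_mul_I_ne_zero l
  rw [← normSq_one_add_mul_I, ← integral_comp_mul_add h z]
  congr 1; funext x
  simp only [resonantIntegrand]
  refine congrArg₂ _ (congrArg₂ _ (congrArg f₁ ?_) (congrArg f₂ ?_))
    (congrArg _ (congrArg f₃ ?_))
  · field_simp; ring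
  · field_simp; ring
  · ring

section Unitary

variable (l : ℝ)

lemma conj_inv_one_add_mul_I :
    starRingEnd ℂ (1 + l * Complex.I)⁻¹ = (1 - l * Complex.I)⁻¹ := by
  simp [sub_eq_add_neg]

lemma conj_mul_inv_one_add_mul_I :
    starRingEnd ℂ (l * Complex.I * (1 + l * Complex.I)⁻¹) =
      -(l * Complex.I) * (1 - l * Complex.I)⁻¹ := by
  rw [map_mul, conj_inv_one_add_mul_I]; simp

lemma rotation_normSq :
    (1 + l * Complex.I : ℂ)⁻¹ * starRingEnd ℂ (1 + l * Complex.I : ℂ)⁻¹ +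
      (l * Complex.I * (1 + l * Complex.I)⁻¹) *
        starRingEnd ℂ (l * Complex.I * (1 + l * Complex.I)⁻¹) = 1 := by
  rw [conj_inv_one_add_mul_I, conj_mul_inv_one_add_mul_I]
  have h1 := one_add_mul_I_ne_zero l
  have h2 := one_sub_mul_I_ne_zero l
  field_simp
  ring

lemma rotation_orthogonal :
    (1 + l * Complex.I : ℂ)⁻¹ * starRingEnd ℂ (l * Complex.I * (1 + l * Complex.I)⁻¹) +
      (l * Complex.I * (1 + l * Complex.I)⁻¹) * starRingEnd ℂ (1 + l * Complex.I)⁻¹ = 0 := by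
  rw [conj_inv_one_add_mul_I, conj_mul_inv_one_add_mul_I]
  ring

end Unitary

/-- The two-particle function `h₁ ⊗ h₂` after the unitary change of variables. -/
noncomputable def rotatedPair (p₁ q₁ p₂ q₂ : ℕ) (l : ℝ) (w z : ℂ) : ℂ :=
  hermiteFun p₁ q₁ ((1 + l * Complex.I)⁻¹ * w + (l * Complex.I * (1 + l * Complex.I)⁻¹) * z) *
    hermiteFun p₂ q₂ ((l * Complex.I * (1 + l * Complex.I)⁻¹) * w + (1 + l * Complex.I)⁻¹ * z)

lemma rotatedPair_mem (p₁ q₁ p₂ q₂ : ℕ) (l : ℝ) :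
    rotatedPair p₁ q₁ p₂ q₂ l ∈ twoParticle (p₁ + p₂) (q₁ + q₂) := by
  have h1 := rotation_normSq l
  have h2 := rotation_orthogonal l
  -- The matrix is symmetric with equal diagonal entries, so the two relations cover all six
  -- orthonormality conditions.
  exact hermiteFun_mul_unitary_mem h1 h2 (by rw [add_comm]; exact h1) h1
    (by rw [add_comm]; exact h1) h2 _ _ _ _

lemma resonantT_hermiteFun (p₁ q₁ p₂ q₂ p₃ q₃ : ℕ) (z : ℂ) :
    resonantT (hermiteFun p₁ q₁) (hermiteFun p₂ q₂) (hermiteFun p₃ q₃) z =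
      ∫ l : ℝ, ((1 + l ^ 2)⁻¹ : ℝ) *
        ∫ w, rotatedPair p₁ q₁ p₂ q₂ l w z * starRingEnd ℂ (hermiteFun p₃ q₃ w) := by
  simp only [resonantT, integral_resonantIntegrand]
  rfl

lemma conj_hermiteFun_mem (p q : ℕ) : (fun z => starRingEnd ℂ (hermiteFun p q z)) ∈ polyGaussian := by
  simp_rw [conj_hermiteFun]; exact hermiteFun_mem _ _

lemma fst_mem_polyGaussian {N M : ℕ} {Y : ℂ → ℂ → ℂ} (hY : Y ∈ twoParticle N M) (z : ℂ) :
    (fun w => Y w z) ∈ polyGaussian := by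
  refine twoParticle_induction (P := fun Y => (fun w => Y w z) ∈ polyGaussian) ?_ ?_ ?_ ?_ hY
  · intro i j k l _ _
    convert Submodule.smul_mem _ (hermiteFun j l z) (hermiteFun_mem i k) using 1
    funext w; simp [mul_comm]
  · exact zero_mem _
  · intro x _ y _ h1 h2; exact add_mem h1 h2
  · intro c x _ h1; exact Submodule.smul_mem _ c h1

lemma integrable_fst_mul_conj {N M : ℕ} {Y : ℂ → ℂ → ℂ} (hY : Y ∈ twoParticle N M) (p q : ℕ)
    (z : ℂ) : Integrable fun w => Y w z * starRingEnd ℂ (hermiteFun p q w) :=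
  integrable_mul_of_mem (fst_mem_polyGaussian hY z) (conj_hermiteFun_mem p q)

/-! ### Selection rule -/

/-- Pairing a two-particle function with `h_{p,q}` in the first variable. -/
lemma exists_partial_pairing {N M p P q Q : ℕ} (hN : p + P = N) (hM : q + Q = M)
    {Y : ℂ → ℂ → ℂ} (hY : Y ∈ twoParticle N M) :
    ∃ k : ℂ, ∀ z, ∫ w, Y w z * starRingEnd ℂ (hermiteFun p q w) = k * hermiteFun P Q z := by
  refine twoParticle_induction (P := fun Y => ∃ k : ℂ, ∀ z,
    ∫ w, Y w z * starRingEnd ℂ (hermiteFun p q w) = k * hermiteFun P Q z) ?_ ?_ ?_ ?_ hY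
  · intro i j k l h1 h2
    refine ⟨if i = p ∧ k = q then (Real.pi : ℂ) * i.factorial * k.factorial else 0, fun z => ?_⟩
    simp_rw [mul_right_comm _ (hermiteFun j l z)]
    rw [integral_mul_const, integral_hermiteFun_mul_conj_hermiteFun]
    split_ifs with h
    -- Once `i = p` and `k = q`, the prescribed totals determine the second factor.
    · rw [show j = P by omega, show l = Q by omega]
    · simp
  · exact ⟨0, fun z => by simp⟩
  · rintro x hx y hy ⟨a, ha⟩ ⟨b, hb⟩
    refine ⟨a + b, fun z => ?_⟩
    simp only [Pi.add_apply, add_mul]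
    rw [integral_add (integrable_fst_mul_conj hx p q z) (integrable_fst_mul_conj hy p q z), ha, hb]
  · rintro c x hx ⟨a, ha⟩
    refine ⟨c * a, fun z => ?_⟩
    simp only [Pi.smul_apply, smul_eq_mul, mul_assoc]
    rw [integral_const_mul, ha]

/-- No product in the space carries so large an index in its first factor. This covers the triples
whose partner would have a negative index, where `φ₄ = 0` by convention. -/
lemma partial_pairing_eq_zero {N M p q : ℕ} (h : N < p ∨ M < q)
    {Y : ℂ → ℂ → ℂ} (hY : Y ∈ twoParticle N M) (z : ℂ) :
    ∫ w, Y w z * starRingEnd ℂ (hermiteFun p q w) = 0 := by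
  refine twoParticle_induction (P := fun Y =>
    ∫ w, Y w z * starRingEnd ℂ (hermiteFun p q w) = 0) ?_ ?_ ?_ ?_ hY
  · intro i j k l h1 h2
    simp_rw [mul_right_comm _ (hermiteFun j l z)]
    rw [integral_mul_const, integral_hermiteFun_mul_conj_hermiteFun, if_neg (by omega), zero_mul]
  · simp
  · intro x hx y hy h1 h2
    simp only [Pi.add_apply, add_mul]
    rw [integral_add (integrable_fst_mul_conj hx p q z) (integrable_fst_mul_conj hy p q z), h1, h2,
      add_zero]
  · intro c x hx h1
    simp only [Pi.smul_apply, smul_eq_mul, mul_assoc]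
    rw [integral_const_mul, h1, mul_zero]

lemma resonantT_hermiteFun_eq_zero {p₁ q₁ p₂ q₂ p₃ q₃ : ℕ} (h : p₁ + p₂ < p₃ ∨ q₁ + q₂ < q₃)
    (z : ℂ) : resonantT (hermiteFun p₁ q₁) (hermiteFun p₂ q₂) (hermiteFun p₃ q₃) z = 0 := by
  simp [resonantT_hermiteFun, partial_pairing_eq_zero h (rotatedPair_mem _ _ _ _ _)]

/-! ### Centered variables and the average over the circle -/

/-- The basis functions of `twoParticle N M`. -/
noncomputable def pairBasis (N M : ℕ) (i : Fin (N + 1) × Fin (M + 1)) (w z : ℂ) : ℂ :=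
  hermiteFun (N - i.1) (M - i.2) w * hermiteFun i.1 i.2 z

lemma exists_coeff {N M : ℕ} {Y : ℂ → ℂ → ℂ} (hY : Y ∈ twoParticle N M) :
    ∃ c : Fin (N + 1) × Fin (M + 1) → ℂ, ∀ w z, Y w z = ∑ i, c i * pairBasis N M i w z := by
  obtain ⟨c, hc⟩ := (Submodule.mem_span_range_iff_exists_fun ℂ).1 hY
  refine ⟨c, fun w z => ?_⟩
  rw [← hc]
  simp [Finset.sum_apply, pairBasis]

/-- `1 / √2`. -/
noncomputable def invSqrtTwo : ℂ := ((Real.sqrt 2)⁻¹ : ℝ)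

lemma invSqrtTwo_mul_self : invSqrtTwo * invSqrtTwo = 1 / 2 := by
  rw [invSqrtTwo, ← Complex.ofReal_mul, ← mul_inv, Real.mul_self_sqrt (by norm_num)]
  norm_num

lemma conj_invSqrtTwo : starRingEnd ℂ invSqrtTwo = invSqrtTwo := Complex.conj_ofReal _

/-- Expansion of `h₁ ⊗ h₂` in the variables `(w + z) / √2`, `(w - z) / √2`. -/
lemma exists_centered_coeff (p₁ q₁ p₂ q₂ : ℕ) :
    ∃ c : Fin (p₁ + p₂ + 1) × Fin (q₁ + q₂ + 1) → ℂ, ∀ w z,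
      hermiteFun p₁ q₁ w * hermiteFun p₂ q₂ z = ∑ i, c i *
        pairBasis (p₁ + p₂) (q₁ + q₂) i (invSqrtTwo * (w + z)) (invSqrtTwo * (w - z)) := by
  have hr := invSqrtTwo_mul_self
  have hc := conj_invSqrtTwo
  obtain ⟨c, h⟩ := exists_coeff (hermiteFun_mul_unitary_mem (a := invSqrtTwo) (b := invSqrtTwo)
    (c := invSqrtTwo) (d := -invSqrtTwo) (by rw [hc]; linear_combination 2 * hr)
    (by rw [map_neg, hc]; ring) (by rw [map_neg, hc]; linear_combination 2 * hr)
    (by rw [hc]; linear_combination 2 * hr) (by rw [map_neg, hc]; linear_combination 2 * hr)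
    (by rw [map_neg, hc]; ring) p₁ q₁ p₂ q₂)
  refine ⟨c, fun w z => ?_⟩
  -- The substitution is an involution, so the expansion evaluated at the centered point returns the
  -- original product.
  rw [← h]
  congr 2
  · linear_combination (-2 * w) * hr
  · linear_combination (-2 * z) * hr

/-- `ζ = (1 - i λ) / (1 + i λ)`. -/
noncomputable def cayley (l : ℝ) : ℂ := (1 - l * Complex.I) / (1 + l * Complex.I)

lemma conj_cayley (l : ℝ) : starRingEnd ℂ (cayley l) = (1 + l * Complex.I) / (1 - l * Complex.I) := by
  simp [cayley, sub_eq_add_neg]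

lemma cayley_mul_conj (l : ℝ) : cayley l * starRingEnd ℂ (cayley l) = 1 := by
  rw [conj_cayley, cayley]
  have h1 := one_add_mul_I_ne_zero l
  have h2 := one_sub_mul_I_ne_zero l
  field_simp

/-- `U_λ` fixes `w + z` and multiplies `w - z` by `ζ`. Only the relative factor of each basis
function changes, and by a phase. The coefficients do not depend on `λ`. -/
lemma rotatedPair_expansion {p₁ q₁ p₂ q₂ : ℕ} {c : Fin (p₁ + p₂ + 1) × Fin (q₁ + q₂ + 1) → ℂ}
    (hc : ∀ w z, hermiteFun p₁ q₁ w * hermiteFun p₂ q₂ z = ∑ i, c i *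
        pairBasis (p₁ + p₂) (q₁ + q₂) i (invSqrtTwo * (w + z)) (invSqrtTwo * (w - z)))
    (l : ℝ) (w z : ℂ) :
    rotatedPair p₁ q₁ p₂ q₂ l w z = ∑ i, (cayley l ^ (i.1 : ℕ) *
      starRingEnd ℂ (cayley l) ^ (i.2 : ℕ)) * (c i *
        pairBasis (p₁ + p₂) (q₁ + q₂) i (invSqrtTwo * (w + z)) (invSqrtTwo * (w - z))) := by
  rw [rotatedPair, hc]
  refine Finset.sum_congr rfl fun i _ => ?_
  have h1 := one_add_mul_I_ne_zero l
  rw [show invSqrtTwo * ((1 + l * Complex.I)⁻¹ * w + l * Complex.I * (1 + l * Complex.I)⁻¹ * z +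
      (l * Complex.I * (1 + l * Complex.I)⁻¹ * w + (1 + l * Complex.I)⁻¹ * z)) =
      invSqrtTwo * (w + z) by field_simp; ring,
    show invSqrtTwo * ((1 + l * Complex.I)⁻¹ * w + l * Complex.I * (1 + l * Complex.I)⁻¹ * z -
      (l * Complex.I * (1 + l * Complex.I)⁻¹ * w + (1 + l * Complex.I)⁻¹ * z)) =
      cayley l * (invSqrtTwo * (w - z)) by rw [cayley]; field_simp; ring]
  rw [pairBasis, pairBasis, hermiteFun_rotate (cayley_mul_conj l)]
  ring

lemma norm_cayley (l : ℝ) : ‖cayley l‖ = 1 := by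
  have h := cayley_mul_conj l
  rw [Complex.mul_conj, Complex.normSq_eq_norm_sq] at h
  have h' : ‖cayley l‖ ^ 2 = 1 := by exact_mod_cast h
  nlinarith [norm_nonneg (cayley l)]

lemma cayley_ne_zero (l : ℝ) : cayley l ≠ 0 := fun h => by
  simpa [h] using norm_cayley l

lemma continuous_cayley : Continuous cayley := by
  unfold cayley
  exact Continuous.div (by fun_prop) (by fun_prop) one_add_mul_I_ne_zero

/-- With `λ = tan θ` one has `ζ = e^{-2iθ}` and `dθ = dλ/(1 + λ²)`, so the weight is the arc length
element up to a constant. -/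
lemma hasDerivAt_cayley (l : ℝ) :
    HasDerivAt cayley (-2 * Complex.I * ((1 + l ^ 2)⁻¹ : ℝ) * cayley l) l := by
  have h1 := one_add_mul_I_ne_zero l
  have h2 := one_sub_mul_I_ne_zero l
  have hl : HasDerivAt (fun l : ℝ => (l : ℂ) * Complex.I) (1 * Complex.I) l :=
    (Complex.ofRealCLM.hasDerivAt (x := l)).mul_const _
  have h := (hl.const_sub 1).div (hl.const_add 1) h1
  refine h.congr_deriv ?_
  have e : ((1 + l ^ 2)⁻¹ : ℝ) = ((1 + l * Complex.I) * (1 - l * Complex.I) : ℂ)⁻¹ := by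
    push_cast
    congr 1
    linear_combination (l ^ 2 : ℂ) * Complex.I_sq
  have hs : (1 + l * Complex.I : ℂ) + (1 - l * Complex.I) = 2 := by ring
  rw [e, cayley]
  generalize (1 + l * Complex.I : ℂ) = A at *
  generalize (1 - l * Complex.I : ℂ) = B at *
  field_simp
  linear_combination -hs

lemma tendsto_cayley_of {u : Filter ℝ} (hu : Filter.Tendsto (fun l : ℝ => ‖(l : ℂ)‖) u Filter.atTop) :
    Filter.Tendsto cayley u (nhds (-1)) := by
  have e : cayley = fun l : ℝ => -1 + 2 * (1 + l * Complex.I)⁻¹ := by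
    funext l
    have h1 := one_add_mul_I_ne_zero l
    rw [cayley]; field_simp; ring
  have h0 : Filter.Tendsto (fun l : ℝ => (1 + l * Complex.I : ℂ)⁻¹) u (nhds 0) := by
    refine Filter.tendsto_inv₀_cobounded.comp (tendsto_norm_atTop_iff_cobounded.1 ?_)
    refine Filter.tendsto_atTop_mono (fun l => ?_) (Filter.tendsto_atTop_add_const_right u (-1) hu)
    have := norm_sub_le (1 + l * Complex.I : ℂ) 1
    simp at this ⊢
    linarith
  rw [e]
  simpa using (h0.const_mul 2).const_add (-1)

lemma integrable_weight_mul_cayley (j k : ℕ) :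
    Integrable fun l : ℝ => (((1 + l ^ 2)⁻¹ : ℝ) : ℂ) *
      (cayley l ^ j * starRingEnd ℂ (cayley l) ^ k) := by
  refine integrable_inv_one_add_sq.ofReal.mul_bdd (c := 1) ?_ ?_
  · have := continuous_cayley
    exact Continuous.aestronglyMeasurable (by fun_prop)
  · exact Filter.Eventually.of_forall fun l => by simp [norm_cayley]

/-- Only the diagonal angular modes survive the average over `λ`. -/
lemma integral_weight_mul_cayley (j k : ℕ) :
    ∫ l : ℝ, (((1 + l ^ 2)⁻¹ : ℝ) : ℂ) * (cayley l ^ j * starRingEnd ℂ (cayley l) ^ k) =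
      if j = k then (Real.pi : ℂ) else 0 := by
  have hz : ∀ l : ℝ, cayley l ^ j * starRingEnd ℂ (cayley l) ^ k = cayley l ^ (j - k : ℤ) :=
    fun l => by
    have : starRingEnd ℂ (cayley l) = (cayley l)⁻¹ :=
      eq_inv_of_mul_eq_one_right (cayley_mul_conj l)
    rw [this, zpow_sub₀ (cayley_ne_zero l)]
    simp [div_eq_mul_inv]
  have hint := integrable_weight_mul_cayley j k
  simp_rw [hz] at hint ⊢
  split_ifs with h
  · have e : ∀ l : ℝ, (((1 + l ^ 2)⁻¹ : ℝ) : ℂ) * cayley l ^ (j - k : ℤ) =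
        (((1 + l ^ 2)⁻¹ : ℝ) : ℂ) := fun l => by simp [h]
    simp_rw [e]
    rw [integral_complex_ofReal, integral_univ_inv_one_add_sq]
  · set n : ℤ := j - k with hn
    have hn0 : (n : ℂ) ≠ 0 := by
      rw [Int.cast_ne_zero]; omega
    -- The factor `i/(2n)` cancels the factor `-2in` that comes from differentiating `ζ^n`.
    have hd : ∀ l : ℝ, HasDerivAt (fun l => (Complex.I / (2 * n)) * cayley l ^ n)
        ((((1 + l ^ 2)⁻¹ : ℝ) : ℂ) * cayley l ^ n) l := fun l => by
      have h1 := ((hasDerivAt_zpow n (cayley l) (Or.inl (cayley_ne_zero l))).comp l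
        (hasDerivAt_cayley l)).const_mul (Complex.I / (2 * n))
      refine h1.congr_deriv ?_
      rw [zpow_sub_one₀ (cayley_ne_zero l)]
      have := cayley_ne_zero l
      generalize (((1 + l ^ 2)⁻¹ : ℝ) : ℂ) = s
      field_simp
      linear_combination (-s) * Complex.I_sq
    have hc : ∀ u : Filter ℝ, Filter.Tendsto (fun l : ℝ => ‖(l : ℂ)‖) u Filter.atTop →
        Filter.Tendsto (fun l => (Complex.I / (2 * n)) * cayley l ^ n) u
          (nhds ((Complex.I / (2 * n)) * (-1) ^ n)) := fun u hu =>
      ((tendsto_cayley_of hu).zpow₀ n (Or.inl (by norm_num))).const_mul _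
    -- The primitive has the same limit at both ends, since `ζ → -1` there: the circle closes up.
    rw [integral_of_hasDerivAt_of_tendsto hd hint (hc _ ?_) (hc _ ?_), sub_self]
    · simpa using Filter.tendsto_abs_atBot_atTop
    · simpa using Filter.tendsto_abs_atTop_atTop

/-! ### Parseval's formula in centered variables -/

/-- The involution `(w, z) ↦ ((w + z) / √2, (w - z) / √2)`. -/
noncomputable def centering : (ℂ × ℂ) →ₗ[ℝ] (ℂ × ℂ) where
  toFun p := (invSqrtTwo * (p.1 + p.2), invSqrtTwo * (p.1 - p.2))
  map_add' p q := by ext <;> simp <;> ring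
  map_smul' c p := by ext <;> simp <;> ring

lemma centering_centering (p : ℂ × ℂ) : centering (centering p) = p := by
  have h := invSqrtTwo_mul_self
  ext1
  · simp only [centering, LinearMap.coe_mk, AddHom.coe_mk]; linear_combination (2 * p.1) * h
  · simp only [centering, LinearMap.coe_mk, AddHom.coe_mk]; linear_combination (2 * p.2) * h

/-- The determinant of an involution squares to `1`, so no determinant has to be computed. -/
lemma measurePreserving_centering : MeasurePreserving centering (volume : Measure (ℂ × ℂ)) volume := by
  have h1 : centering ∘ₗ centering = LinearMap.id := LinearMap.ext centering_centering
  have h2 : LinearMap.det centering * LinearMap.det centering = 1 := by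
    rw [← LinearMap.det_comp, h1, LinearMap.det_id]
  have h0 : LinearMap.det centering ≠ 0 := fun h => by simp [h] at h2
  have h3 : |LinearMap.det centering| = 1 := by
    rw [← abs_mul_abs_self] at h2
    nlinarith [abs_nonneg (LinearMap.det centering)]
  have : (volume : Measure (ℂ × ℂ)).IsAddHaarMeasure := by
    rw [Measure.volume_eq_prod]; infer_instance
  refine ⟨centering.continuous_of_finiteDimensional.measurable, ?_⟩
  rw [Measure.map_linearMap_addHaar_eq_smul_addHaar _ h0, abs_inv, h3]
  simp

lemma integral_comp_centering (f : ℂ × ℂ → ℂ) :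
    ∫ p : ℂ × ℂ, f (centering p) = ∫ p, f p := by
  refine measurePreserving_centering.integral_comp ?_ f
  let e : (ℂ × ℂ) ≃ₗ[ℝ] (ℂ × ℂ) := LinearEquiv.ofInvolutive centering centering_centering
  exact e.toContinuousLinearEquiv.toHomeomorph.measurableEmbedding

lemma pairBasis_mul_conj {N M : ℕ} (i i' : Fin (N + 1) × Fin (M + 1)) (w z : ℂ) :
    pairBasis N M i w z * starRingEnd ℂ (pairBasis N M i' w z) =
      (hermiteFun (N - i.1) (M - i.2) w *
        starRingEnd ℂ (hermiteFun (N - i'.1) (M - i'.2) w)) *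
      (hermiteFun i.1 i.2 z * starRingEnd ℂ (hermiteFun i'.1 i'.2 z)) := by
  simp only [pairBasis, map_mul]; ring

lemma integrable_pairBasis_mul_conj {N M : ℕ} (i i' : Fin (N + 1) × Fin (M + 1)) :
    Integrable fun p : ℂ × ℂ => pairBasis N M i p.1 p.2 *
      starRingEnd ℂ (pairBasis N M i' p.1 p.2) := by
  simp_rw [pairBasis_mul_conj]
  exact (integrable_mul_of_mem (hermiteFun_mem _ _) (conj_hermiteFun_mem _ _)).mul_prod
    (integrable_mul_of_mem (hermiteFun_mem _ _) (conj_hermiteFun_mem _ _))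

/-- The squared norm of the basis function `pairBasis N M i`. -/
noncomputable def pairNorm (N M : ℕ) (i : Fin (N + 1) × Fin (M + 1)) : ℂ :=
  (Real.pi * (N - i.1 : ℕ).factorial * (M - i.2 : ℕ).factorial) *
    (Real.pi * (i.1 : ℕ).factorial * (i.2 : ℕ).factorial)

lemma integral_pairBasis_mul_conj {N M : ℕ} (i i' : Fin (N + 1) × Fin (M + 1)) :
    ∫ p : ℂ × ℂ, pairBasis N M i p.1 p.2 * starRingEnd ℂ (pairBasis N M i' p.1 p.2) =
      if i = i' then pairNorm N M i else 0 := by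
  simp_rw [pairBasis_mul_conj]
  rw [Measure.volume_eq_prod, integral_prod_mul
    (fun w => hermiteFun (N - i.1) (M - i.2) w * starRingEnd ℂ (hermiteFun (N - i'.1) (M - i'.2) w))
    (fun z => hermiteFun i.1 i.2 z * starRingEnd ℂ (hermiteFun i'.1 i'.2 z)),
    integral_hermiteFun_mul_conj_hermiteFun, integral_hermiteFun_mul_conj_hermiteFun]
  by_cases h : i = i'
  · subst h; simp [pairNorm]
  · rw [if_neg h, if_neg (c := (i.1 : ℕ) = i'.1 ∧ (i.2 : ℕ) = i'.2), mul_zero]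
    rintro ⟨h1, h2⟩
    exact h (Prod.ext (Fin.ext h1) (Fin.ext h2))

lemma sum_mul_conj_sum {ι : Type*} [Fintype ι] (a b : ι → ℂ) :
    (∑ i, a i) * starRingEnd ℂ (∑ i, b i) = ∑ i, ∑ i', a i * starRingEnd ℂ (b i') := by
  rw [map_sum, Finset.sum_mul_sum]

/-- Parseval's formula for the basis functions in the variables `(w ± z) / √2`. -/
lemma integral_sum_pairBasis_mul_conj {N M : ℕ} (a b : Fin (N + 1) × Fin (M + 1) → ℂ) :
    ∫ p : ℂ × ℂ,
      (∑ i, a i * pairBasis N M i (invSqrtTwo * (p.1 + p.2)) (invSqrtTwo * (p.1 - p.2))) *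
      starRingEnd ℂ
        (∑ i, b i * pairBasis N M i (invSqrtTwo * (p.1 + p.2)) (invSqrtTwo * (p.1 - p.2))) =
      ∑ i, a i * starRingEnd ℂ (b i) * pairNorm N M i := by
  have e := integral_comp_centering fun p => (∑ i, a i * pairBasis N M i p.1 p.2) *
    starRingEnd ℂ (∑ i, b i * pairBasis N M i p.1 p.2)
  refine e.trans ?_
  have e2 : ∀ i i' (p : ℂ × ℂ), a i * pairBasis N M i p.1 p.2 *
      starRingEnd ℂ (b i' * pairBasis N M i' p.1 p.2) = a i * starRingEnd ℂ (b i') *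
      (pairBasis N M i p.1 p.2 * starRingEnd ℂ (pairBasis N M i' p.1 p.2)) := fun i i' p => by
    rw [map_mul]; ring
  simp_rw [sum_mul_conj_sum, e2]
  have hi : ∀ i i', Integrable fun p : ℂ × ℂ => a i * starRingEnd ℂ (b i') *
      (pairBasis N M i p.1 p.2 * starRingEnd ℂ (pairBasis N M i' p.1 p.2)) :=
    fun i i' => (integrable_pairBasis_mul_conj i i').const_mul _
  rw [integral_finsetSum _ fun i _ => integrable_finsetSum _ fun i' _ => hi i i']
  refine Finset.sum_congr rfl fun i _ => ?_
  rw [integral_finsetSum _ fun i' _ => hi i i']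
  simp_rw [integral_const_mul, integral_pairBasis_mul_conj]
  simp

lemma integrable_twoParticle {N M : ℕ} {Y : ℂ → ℂ → ℂ} (hY : Y ∈ twoParticle N M)
    (p q P Q : ℕ) : Integrable fun x : ℂ × ℂ => Y x.1 x.2 *
      starRingEnd ℂ (hermiteFun p q x.1 * hermiteFun P Q x.2) := by
  refine twoParticle_induction (P := fun Y => Integrable fun x : ℂ × ℂ => Y x.1 x.2 *
    starRingEnd ℂ (hermiteFun p q x.1 * hermiteFun P Q x.2)) ?_ ?_ ?_ ?_ hY
  · intro i j k l _ _
    rw [Measure.volume_eq_prod]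
    convert (integrable_mul_of_mem (hermiteFun_mem i k) (conj_hermiteFun_mem p q)).mul_prod
      (integrable_mul_of_mem (hermiteFun_mem j l) (conj_hermiteFun_mem P Q)) using 2 with x
    rw [map_mul]; ring
  · simp
  · intro x _ y _ h1 h2
    exact (h1.add h2).congr (.of_forall fun v => by simp [add_mul])
  · intro c x _ h1
    exact (h1.const_mul c).congr (.of_forall fun v => by simp [mul_assoc])

lemma integral_twoParticle_mul_conj {N M : ℕ} {Y : ℂ → ℂ → ℂ} (hY : Y ∈ twoParticle N M)
    (p q P Q : ℕ) : ∫ x : ℂ × ℂ, Y x.1 x.2 *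
      starRingEnd ℂ (hermiteFun p q x.1 * hermiteFun P Q x.2) =
      ∫ z, (∫ w, Y w z * starRingEnd ℂ (hermiteFun p q w)) *
        starRingEnd ℂ (hermiteFun P Q z) := by
  rw [Measure.volume_eq_prod, integral_prod_symm _ (integrable_twoParticle hY p q P Q)]
  congr 1; funext z
  rw [← integral_mul_const]
  congr 1; funext w
  rw [map_mul]; ring

/-! ### The quartic integral and the constant `2π²` -/

/-- On the diagonal `w = z` the center variable is `2z/√2 = √2 z`, whose Jacobian produces the
factor `1/2`. -/
lemma integral_hermiteFun_scaled (p q a b : ℕ) :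
    ∫ z, hermiteFun p q (2 * invSqrtTwo * z) * starRingEnd ℂ (hermiteFun a b (2 * invSqrtTwo * z)) =
      1 / 2 * if p = a ∧ q = b then (Real.pi : ℂ) * p.factorial * q.factorial else 0 := by
  have h := invSqrtTwo_mul_self
  have h0 : 2 * invSqrtTwo ≠ 0 := fun h' => by
    have : (2 * invSqrtTwo) * (2 * invSqrtTwo) = 2 := by linear_combination 4 * h
    simp [h'] at this
  have hn : Complex.normSq (2 * invSqrtTwo) = 2 := by
    have : ((Complex.normSq (2 * invSqrtTwo) : ℝ) : ℂ) = 2 := by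
      rw [← Complex.mul_conj, map_mul, conj_invSqrtTwo, map_ofNat]
      linear_combination 4 * h
    exact_mod_cast this
  have := integral_comp_mul_add h0 0
    fun z => hermiteFun p q z * starRingEnd ℂ (hermiteFun a b z)
  rw [hn, integral_hermiteFun_mul_conj_hermiteFun] at this
  simpa using this

/-- For `j = l` this is `1/π` times the squared norm of `h_{j,l}`. Hence evaluating the relative
variable at `0` weighs the modes exactly as the circle average does. -/
lemma hermiteFun_zero_mul_conj (j l : ℕ) :
    hermiteFun j l 0 * starRingEnd ℂ (hermiteFun j l 0) =
      if j = l then (j.factorial : ℂ) * l.factorial else 0 := by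
  split_ifs with h
  · subst h
    rw [hermiteFun_diag_apply_zero]
    simp
    rw [mul_mul_mul_comm, ← mul_pow]
    simp
  · rw [hermiteFun_apply_zero_of_ne h, zero_mul]

/-- The quartic integral in terms of the centered coefficients. -/
lemma integral_quartic_sum {N M : ℕ} (a b : Fin (N + 1) × Fin (M + 1) → ℂ) :
    ∫ z, (∑ i, a i * pairBasis N M i (invSqrtTwo * (z + z)) (invSqrtTwo * (z - z))) *
      starRingEnd ℂ (∑ i, b i * pairBasis N M i (invSqrtTwo * (z + z)) (invSqrtTwo * (z - z))) =
      1 / (2 * Real.pi) * ∑ i, a i * starRingEnd ℂ (b i) * pairNorm N M i *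
        if (i.1 : ℕ) = i.2 then 1 else 0 := by
  have e : ∀ i z, pairBasis N M i (invSqrtTwo * (z + z)) (invSqrtTwo * (z - z)) =
      hermiteFun (N - i.1) (M - i.2) (2 * invSqrtTwo * z) * hermiteFun i.1 i.2 0 := fun i z => by
    rw [pairBasis, sub_self, mul_zero, ← two_mul, ← mul_assoc, mul_comm invSqrtTwo 2]
  have e2 : ∀ i i' z, a i * (hermiteFun (N - i.1) (M - i.2) (2 * invSqrtTwo * z) *
      hermiteFun i.1 i.2 0) * starRingEnd ℂ (b i' * (hermiteFun (N - i'.1) (M - i'.2)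
        (2 * invSqrtTwo * z) * hermiteFun i'.1 i'.2 0)) =
      (a i * starRingEnd ℂ (b i') * (hermiteFun i.1 i.2 0 *
        starRingEnd ℂ (hermiteFun i'.1 i'.2 0))) *
      (hermiteFun (N - i.1) (M - i.2) (2 * invSqrtTwo * z) *
        starRingEnd ℂ (hermiteFun (N - i'.1) (M - i'.2) (2 * invSqrtTwo * z))) := fun i i' z => by
    simp only [map_mul]; ring
  simp_rw [sum_mul_conj_sum, e, e2]
  have h0 : 2 * invSqrtTwo ≠ 0 := fun h' => by
    have : (2 * invSqrtTwo) * (2 * invSqrtTwo) = 2 := by linear_combination 4 * invSqrtTwo_mul_self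
    simp [h'] at this
  have hi : ∀ i i' : Fin (N + 1) × Fin (M + 1), Integrable fun z =>
      (a i * starRingEnd ℂ (b i') * (hermiteFun i.1 i.2 0 *
        starRingEnd ℂ (hermiteFun i'.1 i'.2 0))) *
      (hermiteFun (N - i.1) (M - i.2) (2 * invSqrtTwo * z) *
        starRingEnd ℂ (hermiteFun (N - i'.1) (M - i'.2) (2 * invSqrtTwo * z))) := fun i i' => by
    refine Integrable.const_mul ?_ _
    have := (integrable_mul_of_mem (hermiteFun_mem (N - i.1) (M - i.2))
      (conj_hermiteFun_mem (N - i'.1) (M - i'.2)))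
    have hm : Integrable (fun z => hermiteFun (N - i.1) (M - i.2) z *
        starRingEnd ℂ (hermiteFun (N - i'.1) (M - i'.2) z))
        (Measure.map (fun w : ℂ => 2 * invSqrtTwo * w + 0) volume) := by
      rw [map_mul_add_volume h0]
      exact this.smul_measure ENNReal.ofReal_ne_top
    simpa [Function.comp_def] using (measurableEmbedding_mul_add h0 0).integrable_map_iff.1 hm
  rw [integral_finsetSum _ fun i _ => integrable_finsetSum _ fun i' _ => hi i i', Finset.mul_sum]
  refine Finset.sum_congr rfl fun i _ => ?_
  rw [integral_finsetSum _ fun i' _ => hi i i']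
  simp_rw [integral_const_mul, integral_hermiteFun_scaled]
  -- The center factors are orthogonal unless `N - j = N - j'` and `M - l = M - l'`. The indices are
  -- at most `N` and `M`, so the truncated subtractions are injective and only `i' = i` remains.
  rw [Finset.sum_eq_single i]
  · rw [hermiteFun_zero_mul_conj, pairNorm]
    have := Real.pi_ne_zero
    have : (Real.pi : ℂ) ≠ 0 := by exact_mod_cast this
    simp only [and_self, if_true]
    split_ifs
    · field_simp
    · simp
  · intro i' _ hne
    rw [if_neg]
    · simp
    · rintro ⟨h1, h2⟩
      refine hne (Prod.ext (Fin.ext ?_) (Fin.ext ?_)) <;> omega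
  · simp

/-- The trilinear operator on unnormalized special Hermite functions. -/
lemma exists_resonantT_hermiteFun {p₁ q₁ p₂ q₂ p₃ q₃ p₄ q₄ : ℕ} (hp : p₃ + p₄ = p₁ + p₂)
    (hq : q₃ + q₄ = q₁ + q₂) :
    ∃ k : ℂ, (∀ z, resonantT (hermiteFun p₁ q₁) (hermiteFun p₂ q₂) (hermiteFun p₃ q₃) z =
      k * hermiteFun p₄ q₄ z) ∧
      k * (Real.pi * p₄.factorial * q₄.factorial) = 2 * (Real.pi : ℂ) ^ 2 *
        ∫ x, hermiteFun p₁ q₁ x * hermiteFun p₂ q₂ x *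
          starRingEnd ℂ (hermiteFun p₃ q₃ x * hermiteFun p₄ q₄ x) := by
  choose κ hκ using fun l => exists_partial_pairing hp hq (rotatedPair_mem p₁ q₁ p₂ q₂ l)
  refine ⟨∫ l : ℝ, ((1 + l ^ 2)⁻¹ : ℝ) * κ l, fun z => ?_, ?_⟩
  · simp_rw [resonantT_hermiteFun, hκ, ← mul_assoc]
    rw [integral_mul_const]
  obtain ⟨a, ha⟩ := exists_centered_coeff p₁ q₁ p₂ q₂
  obtain ⟨b, hb⟩ : ∃ b : Fin (p₁ + p₂ + 1) × Fin (q₁ + q₂ + 1) → ℂ, ∀ w z,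
      hermiteFun p₃ q₃ w * hermiteFun p₄ q₄ z = ∑ i, b i *
        pairBasis (p₁ + p₂) (q₁ + q₂) i (invSqrtTwo * (w + z)) (invSqrtTwo * (w - z)) := by
    rw [← hp, ← hq]; exact exists_centered_coeff p₃ q₃ p₄ q₄
  -- Pairing with `h_{p₄,q₄}` in `z` as well turns the unknown `κ l` into a full two-variable inner
  -- product, which Parseval evaluates in centered variables.
  have hl : ∀ l, κ l * (Real.pi * p₄.factorial * q₄.factorial) =
      ∑ i, (cayley l ^ (i.1 : ℕ) * starRingEnd ℂ (cayley l) ^ (i.2 : ℕ)) *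
        (a i * starRingEnd ℂ (b i) * pairNorm _ _ i) := fun l => by
    have h1 := integral_twoParticle_mul_conj (rotatedPair_mem p₁ q₁ p₂ q₂ l) p₃ q₃ p₄ q₄
    simp_rw [hκ, mul_assoc, integral_const_mul, integral_hermiteFun_mul_conj_hermiteFun, hb,
      rotatedPair_expansion ha, ← mul_assoc] at h1
    rw [integral_sum_pairBasis_mul_conj] at h1
    simp only [and_self, if_true] at h1
    rw [← h1]
    exact Finset.sum_congr rfl fun i _ => by ring
  rw [← integral_mul_const]
  simp_rw [mul_assoc _ (κ _), hl, Finset.mul_sum, ← mul_assoc _ (_ * _) (_ * _)]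
  rw [integral_finsetSum _ fun i _ => (integrable_weight_mul_cayley _ _).mul_const _]
  -- Each mode `j = l` now has weight `π` on the left and `2π² · 1/(2π)` on the right.
  simp_rw [integral_mul_const, integral_weight_mul_cayley, ha, hb, integral_quartic_sum]
  rw [← mul_assoc, Finset.mul_sum]
  refine Finset.sum_congr rfl fun i _ => ?_
  have : (Real.pi : ℂ) ≠ 0 := by exact_mod_cast Real.pi_ne_zero
  split_ifs
  · field_simp
  · simp

/-! ### Normalized functions: the formulas for `𝓣` and `𝓔` -/

/-- The normalization constant of the special Hermite functions. -/
noncomputable def hermiteConst (p q : ℕ) : ℝ :=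
  1 / Real.sqrt (Real.pi * p.factorial * q.factorial)

lemma hermiteConst_sq (p q : ℕ) :
    hermiteConst p q * hermiteConst p q * (Real.pi * p.factorial * q.factorial) = 1 := by
  have h : 0 < Real.pi * p.factorial * q.factorial := by positivity
  rw [hermiteConst, div_mul_div_comm, Real.mul_self_sqrt h.le]
  field_simp

lemma specialHermite_natCast (p q : ℕ) :
    specialHermite (p + q) (p - q) = (hermiteConst p q : ℂ) • hermiteFun p q := by
  have h : |(p - q : ℤ)| ≤ p + q ∧ Even (p + q + (p - q) : ℤ) :=
    ⟨abs_le.2 ⟨by omega, by omega⟩, ⟨p, by ring⟩⟩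
  rw [specialHermite, if_pos h]
  have e1 : ((p + q + (p - q) : ℤ) / 2).toNat = p := by omega
  have e2 : ((p + q - (p - q) : ℤ) / 2).toNat = q := by omega
  rw [e1, e2]
  rfl

lemma specialHermite_cases (n m : ℤ) :
    specialHermite n m = 0 ∨ ∃ p q : ℕ, n = p + q ∧ m = p - q := by
  by_cases h : |m| ≤ n ∧ Even (n + m)
  · obtain ⟨h1, k, hk⟩ := h
    obtain ⟨h2, h3⟩ := abs_le.1 h1
    exact Or.inr ⟨k.toNat, (n - k).toNat, by omega, by omega⟩
  · exact Or.inl (if_neg h)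

lemma specialHermite_eq_zero {p q : ℤ} (h : p < 0 ∨ q < 0) :
    specialHermite (p + q) (p - q) = 0 := by
  refine if_neg fun h' => ?_
  obtain ⟨h2, h3⟩ := abs_le.1 h'.1
  omega

lemma resonantT_smul (c₁ c₂ c₃ : ℂ) (f₁ f₂ f₃ : ℂ → ℂ) (z : ℂ) :
    resonantT (c₁ • f₁) (c₂ • f₂) (c₃ • f₃) z =
      c₁ * c₂ * starRingEnd ℂ c₃ * resonantT f₁ f₂ f₃ z := by
  rw [resonantT, resonantT, ← integral_const_mul]
  congr 1; funext l
  rw [← integral_const_mul]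
  congr 1; funext x
  simp only [resonantIntegrand, Pi.smul_apply, smul_eq_mul, map_mul]
  ring

lemma quartic_smul (c₁ c₂ c₃ c₄ : ℂ) (f₁ f₂ f₃ f₄ : ℂ → ℂ) :
    ∫ x, (c₁ • f₁) x * (c₂ • f₂) x * starRingEnd ℂ ((c₃ • f₃) x * (c₄ • f₄) x) =
      c₁ * c₂ * starRingEnd ℂ (c₃ * c₄) *
        ∫ x, f₁ x * f₂ x * starRingEnd ℂ (f₃ x * f₄ x) := by
  rw [← integral_const_mul]
  congr 1; funext x
  simp only [Pi.smul_apply, smul_eq_mul, map_mul]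
  ring

/-- `𝓣(φ₁, φ₂, φ₃) = 2 π² (∫ φ₁ φ₂ conj (φ₃ φ₄)) φ₄`. -/
theorem resonantT_specialHermite (n₁ m₁ n₂ m₂ n₃ m₃ : ℤ) (z : ℂ) :
    resonantT (specialHermite n₁ m₁) (specialHermite n₂ m₂) (specialHermite n₃ m₃) z =
      2 * (Real.pi : ℂ) ^ 2 * (∫ x, specialHermite n₁ m₁ x * specialHermite n₂ m₂ x *
        starRingEnd ℂ (specialHermite n₃ m₃ x *
          specialHermite (n₁ + n₂ - n₃) (m₁ + m₂ - m₃) x)) *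
        specialHermite (n₁ + n₂ - n₃) (m₁ + m₂ - m₃) z := by
  rcases specialHermite_cases n₁ m₁ with h | ⟨p₁, q₁, rfl, rfl⟩
  · simp [h, resonantT, resonantIntegrand]
  rcases specialHermite_cases n₂ m₂ with h | ⟨p₂, q₂, rfl, rfl⟩
  · simp [h, resonantT, resonantIntegrand]
  rcases specialHermite_cases n₃ m₃ with h | ⟨p₃, q₃, rfl, rfl⟩
  · simp [h, resonantT, resonantIntegrand]
  rw [show (p₁ + q₁ + (p₂ + q₂) - (p₃ + q₃) : ℤ) = (p₁ + p₂ - p₃) + (q₁ + q₂ - q₃) by ring,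
    show (p₁ - q₁ + (p₂ - q₂) - (p₃ - q₃) : ℤ) = (p₁ + p₂ - p₃) - (q₁ + q₂ - q₃) by ring]
  -- Here the partner index leaves the quadrant `p, q ≥ 0`, and both sides vanish.
  by_cases h : p₁ + p₂ < p₃ ∨ q₁ + q₂ < q₃
  · rw [specialHermite_eq_zero (p := p₁ + p₂ - p₃) (q := q₁ + q₂ - q₃) (by omega)]
    simp only [specialHermite_natCast, resonantT_smul, resonantT_hermiteFun_eq_zero h]
    simp
  · obtain ⟨p₄, hp⟩ := Nat.exists_eq_add_of_le (show p₃ ≤ p₁ + p₂ by omega)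
    obtain ⟨q₄, hq⟩ := Nat.exists_eq_add_of_le (show q₃ ≤ q₁ + q₂ by omega)
    rw [show (p₁ + p₂ - p₃ : ℤ) = p₄ by omega, show (q₁ + q₂ - q₃ : ℤ) = q₄ by omega]
    obtain ⟨k, hk, hk'⟩ := exists_resonantT_hermiteFun hp.symm hq.symm
    have hc : (hermiteConst p₄ q₄ : ℂ) * hermiteConst p₄ q₄ *
        (Real.pi * p₄.factorial * q₄.factorial) = 1 := by
      exact_mod_cast hermiteConst_sq p₄ q₄
    simp only [specialHermite_natCast, resonantT_smul, hk]
    rw [quartic_smul, map_mul, Complex.conj_ofReal, Complex.conj_ofReal, Pi.smul_apply,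
      smul_eq_mul]
    -- The fourth normalization constant enters twice on the right; its square times `‖h_{p₄,q₄}‖²`
    -- is `1`, which trades `k` for the quartic integral.
    linear_combination (-(hermiteConst p₁ q₁ * hermiteConst p₂ q₂ * hermiteConst p₃ q₃ * k *
      hermiteFun p₄ q₄ z : ℂ)) * hc + (hermiteConst p₁ q₁ * hermiteConst p₂ q₂ *
      hermiteConst p₃ q₃ * hermiteConst p₄ q₄ * hermiteConst p₄ q₄ * hermiteFun p₄ q₄ z : ℂ) * hk'

lemma integral_smul_mul_conj_smul (c d : ℂ) (f g : ℂ → ℂ) :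
    ∫ z, (c • f) z * starRingEnd ℂ ((d • g) z) =
      c * starRingEnd ℂ d * ∫ z, f z * starRingEnd ℂ (g z) := by
  rw [← integral_const_mul]
  congr 1; funext z
  simp only [Pi.smul_apply, smul_eq_mul, map_mul]
  ring

lemma integral_specialHermite_of_ne {n m n' m' : ℤ} (h : ¬(n = n' ∧ m = m')) :
    ∫ z, specialHermite n m z * starRingEnd ℂ (specialHermite n' m' z) = 0 := by
  rcases specialHermite_cases n m with h1 | ⟨p, q, rfl, rfl⟩
  · simp [h1]
  rcases specialHermite_cases n' m' with h1 | ⟨p', q', rfl, rfl⟩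
  · simp [h1]
  rw [specialHermite_natCast, specialHermite_natCast, integral_smul_mul_conj_smul,
    integral_hermiteFun_mul_conj_hermiteFun, if_neg (by omega), mul_zero]

lemma integral_specialHermite_self (p q : ℕ) :
    ∫ z, specialHermite (p + q) (p - q) z * starRingEnd ℂ (specialHermite (p + q) (p - q) z) =
      1 := by
  rw [specialHermite_natCast, integral_smul_mul_conj_smul,
    integral_hermiteFun_mul_conj_hermiteFun, if_pos ⟨rfl, rfl⟩, Complex.conj_ofReal]
  exact_mod_cast hermiteConst_sq p q

/-- The formula for `𝓔` on special Hermite functions. -/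
theorem resonantE_specialHermite (n₁ m₁ n₂ m₂ n₃ m₃ n₄ m₄ : ℤ) :
    resonantE (specialHermite n₁ m₁) (specialHermite n₂ m₂) (specialHermite n₃ m₃)
      (specialHermite n₄ m₄) =
      if n₁ + n₂ = n₃ + n₄ ∧ m₁ + m₂ = m₃ + m₄ then
        2 * (Real.pi : ℂ) ^ 2 * ∫ x, specialHermite n₁ m₁ x * specialHermite n₂ m₂ x *
          starRingEnd ℂ (specialHermite n₃ m₃ x * specialHermite n₄ m₄ x)
      else 0 := by
  simp_rw [resonantE, resonantT_specialHermite, mul_assoc (_ * _ * (∫ _, _))]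
  rw [integral_const_mul]
  split_ifs with h
  · rw [show n₁ + n₂ - n₃ = n₄ by omega, show m₁ + m₂ - m₃ = m₄ by omega]
    rcases specialHermite_cases n₄ m₄ with h1 | ⟨p, q, rfl, rfl⟩
    · simp [h1]
    · rw [integral_specialHermite_self, mul_one]
  · rw [integral_specialHermite_of_ne (by omega), mul_zero]

lemma specialHermite_rotate {u : ℂ} (hu : u * starRingEnd ℂ u = 1) (n m : ℤ) (z : ℂ) :
    specialHermite n m (u * z) = u ^ m * specialHermite n m z := by
  rcases specialHermite_cases n m with h1 | ⟨p, q, rfl, rfl⟩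
  · simp [h1]
  have h0 : u ≠ 0 := left_ne_zero_of_mul_eq_one hu
  have h2 : starRingEnd ℂ u = u⁻¹ := eq_inv_of_mul_eq_one_right hu
  simp only [specialHermite_natCast, Pi.smul_apply, smul_eq_mul, hermiteFun_rotate hu]
  rw [h2, zpow_sub₀ h0]
  simp
  field_simp

/-- Rotation by the angle `π/k`, with `k = m₁ + m₂ - m₃ - m₄`, preserves the integral and multiplies
the integrand by `u^k = -1`. -/
lemma integral_quartic_eq_zero {n₁ m₁ n₂ m₂ n₃ m₃ n₄ m₄ : ℤ} (h : m₁ + m₂ ≠ m₃ + m₄) :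
    ∫ x, specialHermite n₁ m₁ x * specialHermite n₂ m₂ x *
      starRingEnd ℂ (specialHermite n₃ m₃ x * specialHermite n₄ m₄ x) = 0 := by
  set k : ℤ := m₁ + m₂ - m₃ - m₄ with hk
  have hk0 : (k : ℂ) ≠ 0 := by rw [Int.cast_ne_zero]; omega
  set u : ℂ := Complex.exp (Real.pi / k * Complex.I) with hu
  have hu1 : u * starRingEnd ℂ u = 1 := by
    rw [hu, ← Complex.exp_conj, ← Complex.exp_add]
    simp
  have h0 : u ≠ 0 := Complex.exp_ne_zero _
  have h2 : starRingEnd ℂ u = u⁻¹ := eq_inv_of_mul_eq_one_right hu1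
  have huk : u ^ k = -1 := by
    rw [hu, ← Complex.exp_int_mul, ← Complex.exp_pi_mul_I]
    congr 1
    field_simp
  have hn : Complex.normSq u = 1 := by
    rw [Complex.mul_conj] at hu1; exact_mod_cast hu1
  have e := integral_comp_mul_add h0 0 fun x => specialHermite n₁ m₁ x * specialHermite n₂ m₂ x *
      starRingEnd ℂ (specialHermite n₃ m₃ x * specialHermite n₄ m₄ x)
  have e2 : ∀ x, specialHermite n₁ m₁ (u * x) * specialHermite n₂ m₂ (u * x) *
      starRingEnd ℂ (specialHermite n₃ m₃ (u * x) * specialHermite n₄ m₄ (u * x)) =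
      -1 * (specialHermite n₁ m₁ x * specialHermite n₂ m₂ x *
      starRingEnd ℂ (specialHermite n₃ m₃ x * specialHermite n₄ m₄ x)) := fun x => by
    simp only [specialHermite_rotate hu1, map_mul, map_zpow₀, h2]
    rw [← huk, hk, zpow_sub₀ h0, zpow_sub₀ h0, zpow_add₀ h0, inv_zpow, inv_zpow]
    field_simp
  simp only [add_zero, e2, hn] at e
  rw [integral_const_mul] at e
  rw [inv_one, Complex.ofReal_one, one_mul, neg_one_mul] at e
  exact self_eq_neg.1 e.symm

/-! ### Absolute convergence at every point -/

lemma norm_gaussian (z : ℂ) : ‖gaussian z‖ = Real.exp (-‖z‖ ^ 2 / 2) := by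
  rw [gaussian, Complex.norm_exp, Complex.mul_conj, Complex.normSq_eq_norm_sq]
  congr 1
  rw [← Complex.ofReal_neg]
  have : ((-‖z‖ ^ 2 : ℝ) : ℂ) / 2 = ((-‖z‖ ^ 2 / 2 : ℝ) : ℂ) := by push_cast; ring
  rw [this, Complex.ofReal_re]

lemma exists_norm_le_exp_of_mem {f : ℂ → ℂ} (hf : f ∈ polyGaussian) :
    ∃ C : ℝ, 0 ≤ C ∧ ∀ z, ‖f z‖ ≤ C * Real.exp (-‖z‖ ^ 2 / 4) := by
  induction hf using Submodule.span_induction with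
  | mem x h =>
    obtain ⟨⟨a, b⟩, rfl⟩ := h
    -- Half of the Gaussian absorbs the monomial: with `n = a + b`, `|z|^n ≤ 1 + |z|^{2n}`, and one
    -- term of the exponential series gives `|z|^{2n} ≤ 4^n n! e^{|z|²/4}`.
    refine ⟨1 + 4 ^ (a + b) * (a + b).factorial, by positivity, fun z => ?_⟩
    simp only [monomialGaussian, norm_mul, norm_pow, RCLike.norm_conj, norm_gaussian]
    rw [← pow_add, show -‖z‖ ^ 2 / 2 = -‖z‖ ^ 2 / 4 + -‖z‖ ^ 2 / 4 by ring, Real.exp_add,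
      ← mul_assoc]
    refine mul_le_mul_of_nonneg_right ?_ (Real.exp_pos _).le
    rw [neg_div, Real.exp_neg, ← div_eq_mul_inv, div_le_iff₀ (Real.exp_pos _)]
    generalize a + b = n
    have h1 := Real.pow_div_factorial_le_exp (‖z‖ ^ 2 / 4) (by positivity) n
    have h2 : (1 : ℝ) ≤ Real.exp (‖z‖ ^ 2 / 4) := Real.one_le_exp (by positivity)
    rw [div_le_iff₀ (by positivity), div_pow, div_le_iff₀ (by positivity), ← pow_mul] at h1
    have h3 : ‖z‖ ^ n ≤ 1 + ‖z‖ ^ (2 * n) := by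
      rw [pow_mul']
      nlinarith [sq_nonneg (‖z‖ ^ n - 1)]
    nlinarith
  | zero => exact ⟨0, le_rfl, by simp⟩
  | add x y _ _ hx hy =>
    obtain ⟨a, ha, hx⟩ := hx
    obtain ⟨b, hb, hy⟩ := hy
    refine ⟨a + b, by positivity, fun z => ?_⟩
    rw [add_mul]
    exact (norm_add_le _ _).trans (add_le_add (hx z) (hy z))
  | smul c x _ hx =>
    obtain ⟨a, ha, hx⟩ := hx
    refine ⟨‖c‖ * a, by positivity, fun z => ?_⟩
    rw [Pi.smul_apply, norm_smul, mul_assoc]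
    exact mul_le_mul_of_nonneg_left (hx z) (norm_nonneg c)

/-- The defining integral of `𝓣` converges absolutely on (polynomial) × Gaussian functions. -/
theorem integrable_resonantIntegrand_of_mem {f₁ f₂ f₃ : ℂ → ℂ} (h₁ : f₁ ∈ polyGaussian)
    (h₂ : f₂ ∈ polyGaussian) (h₃ : f₃ ∈ polyGaussian) (z : ℂ) :
    Integrable fun p : ℝ × ℂ => resonantIntegrand f₁ f₂ f₃ z p.1 p.2 := by
  obtain ⟨C₁, hC₁, b₁⟩ := exists_norm_le_exp_of_mem h₁
  obtain ⟨C₂, hC₂, b₂⟩ := exists_norm_le_exp_of_mem h₂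
  obtain ⟨C₃, hC₃, b₃⟩ := exists_norm_le_exp_of_mem h₃
  have c₁ := (differentiable_of_mem h₁).continuous
  have c₂ := (differentiable_of_mem h₂).continuous
  have c₃ := (differentiable_of_mem h₃).continuous
  have hg : Integrable fun w : ℂ => Real.exp (-(1 / 4) * ‖w‖ ^ 2) :=
    (Integrable.of_integral_ne_zero (by
      rw [GaussianFourier.integral_rexp_neg_mul_sq_norm (by norm_num)]; positivity))
  have hG : Integrable fun p : ℝ × ℂ => C₁ * C₂ * C₃ *
      Real.exp (-(1 / 4) * ‖(1 + p.1 * Complex.I) * p.2 + z‖ ^ 2) := by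
    refine Integrable.const_mul ?_ _
    refine ⟨Continuous.aestronglyMeasurable (by fun_prop), ?_⟩
    rw [HasFiniteIntegral, Measure.volume_eq_prod, lintegral_prod _ (by fun_prop)]
    simp_rw [fun l : ℝ => lintegral_comp_mul_add (one_add_mul_I_ne_zero l) z
      fun w => ‖Real.exp (-(1 / 4) * ‖w‖ ^ 2)‖ₑ, normSq_one_add_mul_I]
    rw [lintegral_mul_const _ (by fun_prop)]
    exact ENNReal.mul_lt_top integrable_inv_one_add_sq.lintegral_lt_top hg.2
  refine hG.mono' (Continuous.aestronglyMeasurable ?_) (.of_forall fun p => ?_)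
  · unfold resonantIntegrand; fun_prop
  · obtain ⟨l, x⟩ := p
    -- Since `x` and `iλx` are orthogonal, `z`, `x + z`, `x + iλx + z`, `iλx + z` are the vertices
    -- of a rectangle. The Gaussians of `f₁` and `f₂` thus give decay in `(1 + iλ)x + z`, and `f₃`
    -- need only be bounded.
    have e : ‖x + z‖ ^ 2 + ‖l * (Complex.I * x) + z‖ ^ 2 =
        ‖(1 + l * Complex.I) * x + z‖ ^ 2 + ‖z‖ ^ 2 := by
      simp only [← Complex.normSq_eq_norm_sq, Complex.normSq_apply]
      simp
      ring
    simp only [resonantIntegrand, norm_mul, RCLike.norm_conj]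
    have i₃ : ‖f₃ (x + l * (Complex.I * x) + z)‖ ≤ C₃ := (b₃ _).trans
      (mul_le_of_le_one_right hC₃ (Real.exp_le_one_iff.2 (by
        have := sq_nonneg ‖x + l * (Complex.I * x) + z‖; linarith)))
    calc _ ≤ (C₁ * Real.exp (-‖x + z‖ ^ 2 / 4)) *
          (C₂ * Real.exp (-‖l * (Complex.I * x) + z‖ ^ 2 / 4)) * C₃ := by
          gcongr
          · exact b₁ _
          · exact b₂ _
      _ = C₁ * C₂ * C₃ * Real.exp (-‖x + z‖ ^ 2 / 4 + -‖l * (Complex.I * x) + z‖ ^ 2 / 4) := by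
          rw [Real.exp_add]; ring
      _ ≤ _ := by
          gcongr
          nlinarith [sq_nonneg ‖z‖]

/-! ### The `L²` bound for the trilinear operator -/

lemma sq_lintegral_mul_le {α : Type*} [MeasurableSpace α] (μ : Measure α) {f g : α → ENNReal}
    (hf : AEMeasurable f μ) (hg : AEMeasurable g μ) :
    (∫⁻ a, f a * g a ∂μ) ^ 2 ≤ (∫⁻ a, f a ^ 2 ∂μ) * ∫⁻ a, g a ^ 2 ∂μ := by
  have h := ENNReal.lintegral_mul_le_Lp_mul_Lq μ Real.HolderConjugate.two_two hf hg
  calc _ ≤ ((∫⁻ a, f a ^ (2 : ℝ) ∂μ) ^ (1 / 2 : ℝ) * (∫⁻ a, g a ^ (2 : ℝ) ∂μ) ^ (1 / 2 : ℝ)) ^ 2 := by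
        gcongr; exact h
    _ = _ := by
        rw [mul_pow, ← ENNReal.rpow_natCast, ← ENNReal.rpow_natCast, ← ENNReal.rpow_mul,
          ← ENNReal.rpow_mul]
        simp

lemma lintegral_weight : ∫⁻ l : ℝ, ENNReal.ofReal (1 + l ^ 2)⁻¹ = ENNReal.ofReal Real.pi := by
  rw [← integral_univ_inv_one_add_sq, ofReal_integral_eq_lintegral_ofReal
    integrable_inv_one_add_sq (.of_forall fun l => by positivity)]

lemma lintegral_sq_comp_third {f : ℂ → ℂ} (hf : Measurable f) (z : ℂ) :
    ∫⁻ p : ℝ × ℂ, ‖f (p.2 + p.1 * (Complex.I * p.2) + z)‖ₑ ^ 2 =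
      ENNReal.ofReal Real.pi * ∫⁻ w, ‖f w‖ₑ ^ 2 := by
  have e : ∀ (l : ℝ) (x : ℂ), x + l * (Complex.I * x) + z = (1 + l * Complex.I) * x + z :=
    fun l x => by ring
  rw [Measure.volume_eq_prod, lintegral_prod _ (by fun_prop)]
  simp_rw [e, fun l : ℝ => lintegral_comp_mul_add (one_add_mul_I_ne_zero l) z
    fun w => ‖f w‖ₑ ^ 2, normSq_one_add_mul_I]
  rw [lintegral_mul_const _ (by fun_prop), lintegral_weight]

/-- For fixed `λ` the map `(x, z) ↦ (x + z, iλx + z)` has Jacobian `|iλ - 1|² = 1 + λ²`, so the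
double integral factors. The weight `1/(1 + λ²)` integrates to `π`. -/
lemma lintegral_sq_comp_pair {f g : ℂ → ℂ} (hf : Measurable f) (hg : Measurable g) :
    ∫⁻ z, ∫⁻ p : ℝ × ℂ, (‖f (p.2 + z)‖ₑ * ‖g (p.1 * (Complex.I * p.2) + z)‖ₑ) ^ 2 =
      ENNReal.ofReal Real.pi * ((∫⁻ w, ‖f w‖ₑ ^ 2) * ∫⁻ w, ‖g w‖ₑ ^ 2) := by
  have hl : ∀ l : ℝ, ∫⁻ z, ∫⁻ x, (‖f (x + z)‖ₑ * ‖g (l * (Complex.I * x) + z)‖ₑ) ^ 2 =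
      ENNReal.ofReal (1 + l ^ 2)⁻¹ * ((∫⁻ w, ‖f w‖ₑ ^ 2) * ∫⁻ w, ‖g w‖ₑ ^ 2) := fun l => by
    have h0 : (l * Complex.I - 1 : ℂ) ≠ 0 := fun h => by
      have := congrArg Complex.re h
      simp at this
    have hn : Complex.normSq (l * Complex.I - 1) = 1 + l ^ 2 := by
      simp [Complex.normSq_apply]; ring
    rw [lintegral_lintegral_swap (by fun_prop)]
    have e : ∀ x, ∫⁻ z, (‖f (x + z)‖ₑ * ‖g (l * (Complex.I * x) + z)‖ₑ) ^ 2 =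
        ∫⁻ z, (‖f z‖ₑ * ‖g ((l * Complex.I - 1) * x + z)‖ₑ) ^ 2 := fun x => by
      refine Eq.trans ?_ (lintegral_add_left_eq_self
        (fun z => (‖f z‖ₑ * ‖g ((l * Complex.I - 1) * x + z)‖ₑ) ^ 2) x)
      congr 1; funext z
      rw [show (l * Complex.I - 1) * x + (x + z) = l * (Complex.I * x) + z by ring]
    simp_rw [e]
    rw [lintegral_lintegral_swap (by fun_prop)]
    simp_rw [mul_pow]
    have e2 : ∀ z, ∫⁻ x, ‖f z‖ₑ ^ 2 * ‖g ((l * Complex.I - 1) * x + z)‖ₑ ^ 2 =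
        ‖f z‖ₑ ^ 2 * (ENNReal.ofReal (1 + l ^ 2)⁻¹ * ∫⁻ w, ‖g w‖ₑ ^ 2) := fun z => by
      rw [lintegral_const_mul _ (by fun_prop),
        lintegral_comp_mul_add h0 z (fun w => ‖g w‖ₑ ^ 2), hn]
    simp_rw [e2]
    rw [lintegral_mul_const _ (by fun_prop)]
    ring
  have e : ∀ z, ∫⁻ p : ℝ × ℂ, (‖f (p.2 + z)‖ₑ * ‖g (p.1 * (Complex.I * p.2) + z)‖ₑ) ^ 2 =
      ∫⁻ l : ℝ, ∫⁻ x, (‖f (x + z)‖ₑ * ‖g (l * (Complex.I * x) + z)‖ₑ) ^ 2 := fun z => by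
    rw [Measure.volume_eq_prod, lintegral_prod _ (by fun_prop)]
  simp_rw [e]
  rw [lintegral_lintegral_swap (by fun_prop)]
  simp_rw [hl]
  rw [lintegral_mul_const _ (by fun_prop), lintegral_weight]

lemma measurable_resonantIntegrand {f₁ f₂ f₃ : ℂ → ℂ} (h₁ : Measurable f₁) (h₂ : Measurable f₂)
    (h₃ : Measurable f₃) :
    Measurable fun p : (ℂ × ℝ) × ℂ => resonantIntegrand f₁ f₂ f₃ p.1.1 p.1.2 p.2 := by
  unfold resonantIntegrand; fun_prop

/-- The `L²` bound for the trilinear operator, in absolute value. -/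
lemma lintegral_sq_resonantIntegrand_le {f₁ f₂ f₃ : ℂ → ℂ} (h₁ : Measurable f₁)
    (h₂ : Measurable f₂) (h₃ : Measurable f₃) :
    ∫⁻ z, (∫⁻ p : ℝ × ℂ, ‖resonantIntegrand f₁ f₂ f₃ z p.1 p.2‖ₑ) ^ 2 ≤
      ENNReal.ofReal Real.pi ^ 2 *
        ((∫⁻ w, ‖f₁ w‖ₑ ^ 2) * (∫⁻ w, ‖f₂ w‖ₑ ^ 2) * ∫⁻ w, ‖f₃ w‖ₑ ^ 2) := by
  calc _ ≤ ∫⁻ z, (∫⁻ p : ℝ × ℂ, (‖f₁ (p.2 + z)‖ₑ * ‖f₂ (p.1 * (Complex.I * p.2) + z)‖ₑ) ^ 2) *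
        (ENNReal.ofReal Real.pi * ∫⁻ w, ‖f₃ w‖ₑ ^ 2) := by
        refine lintegral_mono fun z => ?_
        -- Cauchy-Schwarz in `(λ, x)` puts `f₁ f₂` against `f₃`; the factor from `f₃` does not
        -- depend on `z`.
        rw [← lintegral_sq_comp_third h₃ z]
        simp only [resonantIntegrand, enorm_mul, RCLike.enorm_conj]
        exact sq_lintegral_mul_le _ (by fun_prop) (by fun_prop)
    _ = _ := by
        rw [lintegral_mul_const _ (by fun_prop), lintegral_sq_comp_pair h₁ h₂]
        ring

lemma measurable_lintegral_resonantIntegrand {f₁ f₂ f₃ : ℂ → ℂ} (h₁ : Measurable f₁)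
    (h₂ : Measurable f₂) (h₃ : Measurable f₃) :
    Measurable fun z => ∫⁻ p : ℝ × ℂ, ‖resonantIntegrand f₁ f₂ f₃ z p.1 p.2‖ₑ := by
  simp only [resonantIntegrand, enorm_mul, RCLike.enorm_conj]
  fun_prop

lemma lintegral_enorm_sq (f : ℂ → ℂ) : ∫⁻ w, ‖f w‖ₑ ^ 2 = eLpNorm f 2 volume ^ 2 := by
  have := eLpNorm_nnreal_pow_eq_lintegral (f := f) (μ := volume) (p := 2) two_ne_zero
  simpa using this.symm

/-- The trilinear operator converges absolutely at almost every point. -/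
lemma ae_integrable_resonantIntegrand {f₁ f₂ f₃ : ℂ → ℂ} (h₁ : Measurable f₁)
    (h₂ : Measurable f₂) (h₃ : Measurable f₃) (m₁ : MemLp f₁ 2) (m₂ : MemLp f₂ 2)
    (m₃ : MemLp f₃ 2) :
    ∀ᵐ z, Integrable fun p : ℝ × ℂ => resonantIntegrand f₁ f₂ f₃ z p.1 p.2 := by
  have hb := lintegral_sq_resonantIntegrand_le h₁ h₂ h₃
  have hfin : ∫⁻ z, (∫⁻ p : ℝ × ℂ, ‖resonantIntegrand f₁ f₂ f₃ z p.1 p.2‖ₑ) ^ 2 ≠ ⊤ := by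
    refine (hb.trans_lt ?_).ne
    simp only [lintegral_enorm_sq]
    exact ENNReal.mul_lt_top (ENNReal.pow_lt_top ENNReal.ofReal_lt_top) (ENNReal.mul_lt_top
      (ENNReal.mul_lt_top (ENNReal.pow_lt_top m₁.2) (ENNReal.pow_lt_top m₂.2))
      (ENNReal.pow_lt_top m₃.2))
  filter_upwards [ae_lt_top ((measurable_lintegral_resonantIntegrand h₁ h₂ h₃).pow_const 2) hfin]
    with z hz
  refine ⟨((measurable_resonantIntegrand h₁ h₂ h₃).comp
    (by fun_prop : Measurable fun p : ℝ × ℂ => ((z, p.1), p.2))).aestronglyMeasurable, ?_⟩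
  exact (ENNReal.pow_lt_top_iff.1 hz).resolve_right two_ne_zero

lemma stronglyMeasurable_resonantT {f₁ f₂ f₃ : ℂ → ℂ} (h₁ : Measurable f₁)
    (h₂ : Measurable f₂) (h₃ : Measurable f₃) : StronglyMeasurable (resonantT f₁ f₂ f₃) := by
  have h : StronglyMeasurable fun q : ℂ × ℝ => ∫ x, resonantIntegrand f₁ f₂ f₃ q.1 q.2 x :=
    (measurable_resonantIntegrand h₁ h₂ h₃).stronglyMeasurable.integral_prod_right'
  exact h.integral_prod_right'

lemma enorm_resonantT_le {f₁ f₂ f₃ : ℂ → ℂ} (h₁ : Measurable f₁)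
    (h₂ : Measurable f₂) (h₃ : Measurable f₃) (z : ℂ) :
    ‖resonantT f₁ f₂ f₃ z‖ₑ ≤ ∫⁻ p : ℝ × ℂ, ‖resonantIntegrand f₁ f₂ f₃ z p.1 p.2‖ₑ := by
  rw [Measure.volume_eq_prod, lintegral_prod _ (by
    simp only [resonantIntegrand, enorm_mul, RCLike.enorm_conj]; fun_prop)]
  exact (enorm_integral_le_lintegral_enorm _).trans
    (lintegral_mono fun l => enorm_integral_le_lintegral_enorm _)

lemma eLpNorm_resonantT_le {f₁ f₂ f₃ : ℂ → ℂ} (h₁ : Measurable f₁)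
    (h₂ : Measurable f₂) (h₃ : Measurable f₃) :
    eLpNorm (resonantT f₁ f₂ f₃) 2 volume ≤ ENNReal.ofReal Real.pi *
      (eLpNorm f₁ 2 volume * eLpNorm f₂ 2 volume * eLpNorm f₃ 2 volume) := by
  rw [← ENNReal.pow_le_pow_left_iff two_ne_zero]
  rw [← lintegral_enorm_sq, mul_pow, mul_pow, mul_pow]
  simp only [← lintegral_enorm_sq]
  refine le_trans (lintegral_mono fun z => ?_) (lintegral_sq_resonantIntegrand_le h₁ h₂ h₃)
  gcongr
  exact enorm_resonantT_le h₁ h₂ h₃ z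

/-! ### The trilinear operator on `L²` -/

lemma memLp_resonantT (u v w : L2Plane) : MemLp (resonantT u v w) 2 volume := by
  have hm := fun u : L2Plane => (Lp.stronglyMeasurable u).measurable
  refine ⟨(stronglyMeasurable_resonantT (hm u) (hm v) (hm w)).aestronglyMeasurable,
    (eLpNorm_resonantT_le (hm u) (hm v) (hm w)).trans_lt ?_⟩
  exact ENNReal.mul_lt_top ENNReal.ofReal_lt_top (ENNReal.mul_lt_top
    (ENNReal.mul_lt_top (Lp.eLpNorm_lt_top u) (Lp.eLpNorm_lt_top v)) (Lp.eLpNorm_lt_top w))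

/-- The trilinear operator on `L²`. -/
noncomputable def resonantL2 (u v w : L2Plane) : L2Plane :=
  (memLp_resonantT u v w).toLp (resonantT u v w)

lemma coeFn_resonantL2 (u v w : L2Plane) : resonantL2 u v w =ᵐ[volume] resonantT u v w :=
  MemLp.coeFn_toLp _

lemma norm_resonantL2_le (u v w : L2Plane) :
    ‖resonantL2 u v w‖ ≤ Real.pi * (‖u‖ * ‖v‖ * ‖w‖) := by
  have hm := fun u : L2Plane => (Lp.stronglyMeasurable u).measurable
  rw [resonantL2, Lp.norm_toLp]
  refine ENNReal.toReal_le_of_le_ofReal (by positivity)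
    ((eLpNorm_resonantT_le (hm u) (hm v) (hm w)).trans_eq ?_)
  rw [ENNReal.ofReal_mul Real.pi_pos.le, ENNReal.ofReal_mul (by positivity),
    ENNReal.ofReal_mul (by positivity)]
  simp only [Lp.norm_def, ENNReal.ofReal_toReal (Lp.eLpNorm_ne_top _)]

lemma ae_comp_mul_add {f g : ℂ → ℂ} (h : f =ᵐ[volume] g) {a : ℂ} (ha : a ≠ 0) (b : ℂ) :
    ∀ᵐ x, f (a * x + b) = g (a * x + b) := by
  have : Measure.QuasiMeasurePreserving (fun w : ℂ => a * w + b) volume volume :=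
    ⟨by fun_prop, by rw [map_mul_add_volume ha]; exact Measure.smul_absolutelyContinuous⟩
  exact this.ae h

/-- `𝓣` depends only on the classes of its arguments modulo null sets. -/
lemma resonantT_congr_ae {f₁ f₂ f₃ g₁ g₂ g₃ : ℂ → ℂ} (h₁ : f₁ =ᵐ[volume] g₁)
    (h₂ : f₂ =ᵐ[volume] g₂) (h₃ : f₃ =ᵐ[volume] g₃) : resonantT f₁ f₂ f₃ = resonantT g₁ g₂ g₃ := by
  funext z
  refine integral_congr_ae ?_
  -- At `λ = 0` the argument `iλx + z` of `f₂` is constant in `x` and could lie in a null set, so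
  -- this value is discarded.
  filter_upwards [compl_mem_ae_iff.2 (measure_singleton (μ := (volume : Measure ℝ)) 0)] with l hl
  have hl' : (l * Complex.I : ℂ) ≠ 0 :=
    mul_ne_zero (Complex.ofReal_ne_zero.2 hl) Complex.I_ne_zero
  refine integral_congr_ae ?_
  filter_upwards [ae_comp_mul_add h₁ one_ne_zero z, ae_comp_mul_add h₂ hl' z,
    ae_comp_mul_add h₃ (one_add_mul_I_ne_zero l) z] with x e₁ e₂ e₃
  simp only [resonantIntegrand]
  rw [show x + l * (Complex.I * x) + z = (1 + l * Complex.I) * x + z by ring,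
    show l * (Complex.I * x) + z = l * Complex.I * x + z by ring, e₂, e₃]
  rw [one_mul] at e₁
  rw [e₁]

lemma resonantT_eq_integral_prod {f₁ f₂ f₃ : ℂ → ℂ} {z : ℂ}
    (h : Integrable fun p : ℝ × ℂ => resonantIntegrand f₁ f₂ f₃ z p.1 p.2) :
    resonantT f₁ f₂ f₃ z = ∫ p : ℝ × ℂ, resonantIntegrand f₁ f₂ f₃ z p.1 p.2 := by
  rw [Measure.volume_eq_prod] at h ⊢
  rw [integral_prod _ h]
  rfl

/-- Additivity is taken from the integral over the product space, where absolute convergence of the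
two summands is available. Stating it for the integrands serves all three arguments at once. -/
lemma resonantT_eq_add {f₁ f₂ f₃ g₁ g₂ g₃ k₁ k₂ k₃ : ℂ → ℂ} {z : ℂ}
    (h : ∀ l x, resonantIntegrand f₁ f₂ f₃ z l x =
      resonantIntegrand g₁ g₂ g₃ z l x + resonantIntegrand k₁ k₂ k₃ z l x)
    (hg : Integrable fun p : ℝ × ℂ => resonantIntegrand g₁ g₂ g₃ z p.1 p.2)
    (hk : Integrable fun p : ℝ × ℂ => resonantIntegrand k₁ k₂ k₃ z p.1 p.2) :
    resonantT f₁ f₂ f₃ z = resonantT g₁ g₂ g₃ z + resonantT k₁ k₂ k₃ z := by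
  have e : (fun p : ℝ × ℂ => resonantIntegrand f₁ f₂ f₃ z p.1 p.2) =
      fun p => resonantIntegrand g₁ g₂ g₃ z p.1 p.2 + resonantIntegrand k₁ k₂ k₃ z p.1 p.2 :=
    funext fun p => h p.1 p.2
  rw [resonantT_eq_integral_prod hg, resonantT_eq_integral_prod hk, ← integral_add hg hk, ← e]
  refine resonantT_eq_integral_prod ?_
  rw [e]
  exact hg.add hk

lemma ae_integrable_resonantIntegrand_L2 (u v w : L2Plane) :
    ∀ᵐ z, Integrable fun p : ℝ × ℂ => resonantIntegrand u v w z p.1 p.2 :=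
  have hm := fun u : L2Plane => (Lp.stronglyMeasurable u).measurable
  ae_integrable_resonantIntegrand (hm u) (hm v) (hm w) (Lp.memLp u) (Lp.memLp v) (Lp.memLp w)

/-- Additivity of the trilinear operator, for any decomposition of its integrand. -/
lemma resonantL2_eq_add {u v w u' v' w' u'' v'' w'' : L2Plane} {f₁ f₂ f₃ : ℂ → ℂ}
    (h₁ : u =ᵐ[volume] f₁) (h₂ : v =ᵐ[volume] f₂) (h₃ : w =ᵐ[volume] f₃)
    (h : ∀ z l x, resonantIntegrand f₁ f₂ f₃ z l x =
      resonantIntegrand u' v' w' z l x + resonantIntegrand u'' v'' w'' z l x) :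
    resonantL2 u v w = resonantL2 u' v' w' + resonantL2 u'' v'' w'' := by
  apply Lp.ext
  filter_upwards [coeFn_resonantL2 u v w, coeFn_resonantL2 u' v' w', coeFn_resonantL2 u'' v'' w'',
    Lp.coeFn_add (resonantL2 u' v' w') (resonantL2 u'' v'' w''),
    ae_integrable_resonantIntegrand_L2 u' v' w', ae_integrable_resonantIntegrand_L2 u'' v'' w'']
    with z e e' e'' e_add i' i''
  rw [e_add, Pi.add_apply, e, e', e'', resonantT_congr_ae h₁ h₂ h₃]
  exact resonantT_eq_add (h z) i' i''

lemma resonantL2_add_fst (u u' v w : L2Plane) :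
    resonantL2 (u + u') v w = resonantL2 u v w + resonantL2 u' v w :=
  resonantL2_eq_add (Lp.coeFn_add u u') .rfl .rfl fun z l x => by
    simp only [resonantIntegrand, Pi.add_apply]; ring

lemma resonantL2_add_snd (u v v' w : L2Plane) :
    resonantL2 u (v + v') w = resonantL2 u v w + resonantL2 u v' w :=
  resonantL2_eq_add .rfl (Lp.coeFn_add v v') .rfl fun z l x => by
    simp only [resonantIntegrand, Pi.add_apply]; ring

lemma resonantL2_add_trd (u v w w' : L2Plane) :
    resonantL2 u v (w + w') = resonantL2 u v w + resonantL2 u v w' :=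
  resonantL2_eq_add .rfl .rfl (Lp.coeFn_add w w') fun z l x => by
    simp only [resonantIntegrand, Pi.add_apply, map_add]; ring

lemma resonantT_coeFn_smul (a b c : ℂ) (u v w : L2Plane) (z : ℂ) :
    resonantT ↑(a • u) ↑(b • v) ↑(c • w) z =
      a * b * starRingEnd ℂ c * resonantT u v w z := by
  rw [resonantT_congr_ae (Lp.coeFn_smul a u) (Lp.coeFn_smul b v) (Lp.coeFn_smul c w),
    resonantT_smul]

lemma resonantL2_smul (a b c : ℂ) (u v w : L2Plane) :
    resonantL2 (a • u) (b • v) (c • w) = (a * b * starRingEnd ℂ c) • resonantL2 u v w := by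
  apply Lp.ext
  filter_upwards [coeFn_resonantL2 (a • u) (b • v) (c • w), coeFn_resonantL2 u v w,
    Lp.coeFn_smul (a * b * starRingEnd ℂ c) (resonantL2 u v w)] with z e e' e''
  rw [e, e'', Pi.smul_apply, e', resonantT_coeFn_smul, smul_eq_mul]

lemma coeFn_specialHermiteL2 (n m : ℤ) : specialHermiteL2 n m =ᵐ[volume] specialHermite n m :=
  MemLp.coeFn_toLp _

lemma resonantT_specialHermiteL2 (n₁ m₁ n₂ m₂ n₃ m₃ : ℤ) :
    resonantT (specialHermiteL2 n₁ m₁) (specialHermiteL2 n₂ m₂) (specialHermiteL2 n₃ m₃) =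
      resonantT (specialHermite n₁ m₁) (specialHermite n₂ m₂) (specialHermite n₃ m₃) :=
  resonantT_congr_ae (coeFn_specialHermiteL2 _ _) (coeFn_specialHermiteL2 _ _)
    (coeFn_specialHermiteL2 _ _)

lemma exists_resonantL2_specialHermiteL2 (n₁ m₁ n₂ m₂ n₃ m₃ : ℤ) :
    ∃ c : ℂ, resonantL2 (specialHermiteL2 n₁ m₁) (specialHermiteL2 n₂ m₂)
      (specialHermiteL2 n₃ m₃) = c • specialHermiteL2 (n₁ + n₂ - n₃) (m₁ + m₂ - m₃) := by
  let c : ℂ := 2 * (Real.pi : ℂ) ^ 2 * ∫ x, specialHermite n₁ m₁ x * specialHermite n₂ m₂ x *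
    starRingEnd ℂ (specialHermite n₃ m₃ x * specialHermite (n₁ + n₂ - n₃) (m₁ + m₂ - m₃) x)
  refine ⟨c, Lp.ext ?_⟩
  filter_upwards [coeFn_resonantL2 (specialHermiteL2 n₁ m₁) (specialHermiteL2 n₂ m₂)
    (specialHermiteL2 n₃ m₃), Lp.coeFn_smul c (specialHermiteL2 (n₁ + n₂ - n₃) (m₁ + m₂ - m₃)),
    coeFn_specialHermiteL2 (n₁ + n₂ - n₃) (m₁ + m₂ - m₃)] with z e e' e''
  rw [e, e', Pi.smul_apply, e'', resonantT_specialHermiteL2, resonantT_specialHermite, smul_eq_mul]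

/-! ### Closed spans stable under `𝓣` -/

/-- The preimage of a closed subspace under a bounded semilinear map is a closed subspace, so
membership is tested on generators. The general `σ` covers the third argument of `𝓣`, which is
conjugate linear. -/
lemma mem_of_mem_hermiteSpan {σ : ℂ →+* ℂ} {S : Set (ℤ × ℤ)} {V : Submodule ℂ L2Plane}
    (hV : IsClosed (V : Set L2Plane)) (L : L2Plane →ₛₗ[σ] L2Plane) {C : ℝ}
    (hL : ∀ u, ‖L u‖ ≤ C * ‖u‖) (h : ∀ p ∈ S, L (specialHermiteL2 p.1 p.2) ∈ V)
    {u : L2Plane} (hu : u ∈ hermiteSpan S) : L u ∈ V := by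
  have hc : Continuous L := AddMonoidHomClass.continuous_of_bound L C hL
  have : hermiteSpan S ≤ V.comap L := by
    refine Submodule.topologicalClosure_minimal _ (Submodule.span_le.2 ?_) (hV.preimage hc)
    rintro _ ⟨p, hp, rfl⟩
    exact h p hp
  exact this hu

/-- The closed spans are stable under `𝓣` when their index sets are stable under
`(p₁, p₂, p₃) ↦ p₁ + p₂ - p₃`. -/
lemma resonantL2_mem_hermiteSpan {S : Set (ℤ × ℤ)}
    (hS : ∀ p₁ ∈ S, ∀ p₂ ∈ S, ∀ p₃ ∈ S, p₁ + p₂ - p₃ ∈ S) {u v w : L2Plane}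
    (hu : u ∈ hermiteSpan S) (hv : v ∈ hermiteSpan S) (hw : w ∈ hermiteSpan S) :
    resonantL2 u v w ∈ hermiteSpan S := by
  have hV : IsClosed (hermiteSpan S : Set L2Plane) := Submodule.isClosed_topologicalClosure _
  let L₁ (v w : L2Plane) : L2Plane →ₗ[ℂ] L2Plane :=
    { toFun := fun u => resonantL2 u v w
      map_add' := fun u u' => resonantL2_add_fst u u' v w
      map_smul' := fun c u => by simpa using resonantL2_smul c 1 1 u v w }
  let L₂ (u w : L2Plane) : L2Plane →ₗ[ℂ] L2Plane :=
    { toFun := fun v => resonantL2 u v w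
      map_add' := fun v v' => resonantL2_add_snd u v v' w
      map_smul' := fun c v => by simpa using resonantL2_smul 1 c 1 u v w }
  let L₃ (u v : L2Plane) : L2Plane →ₛₗ[starRingEnd ℂ] L2Plane :=
    { toFun := fun w => resonantL2 u v w
      map_add' := fun w w' => resonantL2_add_trd u v w w'
      map_smul' := fun c w => by simpa using resonantL2_smul 1 1 c u v w }
  -- The arguments are reduced to generators one at a time, the others being held fixed.
  refine mem_of_mem_hermiteSpan hV (L₃ u v) (C := Real.pi * (‖u‖ * ‖v‖))
    (fun w => (norm_resonantL2_le u v w).trans_eq (by ring)) (fun p₃ h₃ => ?_) hw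
  refine mem_of_mem_hermiteSpan hV (L₂ u _) (C := Real.pi * (‖u‖ * ‖specialHermiteL2 p₃.1 p₃.2‖))
    (fun v => (norm_resonantL2_le u v _).trans_eq (by ring)) (fun p₂ h₂ => ?_) hv
  refine mem_of_mem_hermiteSpan hV (L₁ _ _)
    (C := Real.pi * (‖specialHermiteL2 p₂.1 p₂.2‖ * ‖specialHermiteL2 p₃.1 p₃.2‖))
    (fun u => (norm_resonantL2_le u _ _).trans_eq (by ring)) (fun p₁ h₁ => ?_) hu
  obtain ⟨c, hc⟩ := exists_resonantL2_specialHermiteL2 p₁.1 p₁.2 p₂.1 p₂.2 p₃.1 p₃.2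
  change resonantL2 _ _ _ ∈ _
  rw [hc]
  exact Submodule.smul_mem _ c (Submodule.le_topologicalClosure _
    (Submodule.subset_span ⟨_, hS p₁ h₁ p₂ h₂ p₃ h₃, rfl⟩))

/-! ### Stationary waves -/

/-- Every special Hermite function is a stationary wave. -/
theorem exists_isStationaryWave (n m : ℤ) :
    ∃ ω : ℝ, (ω : ℂ) = resonantE (specialHermite n m) (specialHermite n m) (specialHermite n m)
      (specialHermite n m) ∧ IsStationaryWave (specialHermiteL2 n m) ω := by
  have hE := resonantE_specialHermite n m n m n m n m
  rw [if_pos ⟨rfl, rfl⟩] at hE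
  have hT : ∀ z, resonantT (specialHermite n m) (specialHermite n m) (specialHermite n m) z =
      resonantE (specialHermite n m) (specialHermite n m) (specialHermite n m)
        (specialHermite n m) * specialHermite n m z := fun z => by
    rw [hE, resonantT_specialHermite, add_sub_cancel_right, add_sub_cancel_right]
  -- With four equal functions the quartic integrand is `|φ²|²`, so the frequency is real.
  set ω : ℝ := 2 * Real.pi ^ 2 * ∫ x, Complex.normSq (specialHermite n m x * specialHermite n m x)
    with hω
  have hωE : (ω : ℂ) = resonantE (specialHermite n m) (specialHermite n m) (specialHermite n m)
      (specialHermite n m) := by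
    rw [hE, hω]
    push_cast
    rw [← integral_complex_ofReal]
    simp only [Complex.mul_conj]
  refine ⟨ω, hωE, fun t _ => ?_⟩
  rw [← hωE] at hT
  have hexp : HasDerivAt (fun t : ℝ => Complex.exp (-(Complex.I * ω * t)))
      (Complex.exp (-(Complex.I * ω * t)) * -(Complex.I * ω * 1)) t :=
    (((Complex.ofRealCLM.hasDerivAt (x := t)).const_mul (Complex.I * ω)).neg).cexp
  refine ⟨_, (hexp.smul_const (specialHermiteL2 n m)).hasDerivWithinAt, ?_⟩
  set c := Complex.exp (-(Complex.I * ω * t)) with hc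
  -- As `|c| = 1`, `𝓣(cφ, cφ, cφ) = c² c̄ 𝓣(φ, φ, φ) = c 𝓣(φ, φ, φ)`: the cubic term carries the
  -- same phase as the wave.
  have hcc : c * starRingEnd ℂ c = 1 := by
    rw [hc, ← Complex.exp_conj, ← Complex.exp_add]
    simp
  filter_upwards [Lp.coeFn_smul (c * -(Complex.I * ω * 1)) (specialHermiteL2 n m),
    coeFn_specialHermiteL2 n m] with z e e'
  rw [e, resonantT_coeFn_smul, resonantT_specialHermiteL2, hT, Pi.smul_apply, e', smul_eq_mul]
  linear_combination (-c * ω * specialHermite n m z) * Complex.I_sq -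
    (c * ω * specialHermite n m z) * hcc

/-! ### Dynamical invariance -/

/-- The time derivative of a solution. -/
lemma IsSolutionOn.hasDerivWithinAt {I : Set ℝ} {u : ℝ → L2Plane} (h : IsSolutionOn I u) {t : ℝ}
    (ht : t ∈ I) : HasDerivWithinAt u (-Complex.I • resonantL2 (u t) (u t) (u t)) I t := by
  obtain ⟨v, hv, hv'⟩ := h t ht
  convert hv using 1
  apply Lp.ext
  filter_upwards [hv', Lp.coeFn_smul (-Complex.I) (resonantL2 (u t) (u t) (u t)),
    coeFn_resonantL2 (u t) (u t) (u t)] with z e e' e''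
  rw [e', Pi.smul_apply, e'', ← e, smul_eq_mul]
  linear_combination (-v z) * Complex.I_sq

/-- Telescoping in the three arguments; this is the local Lipschitz bound behind the Grönwall
argument. -/
lemma norm_resonantL2_sub_le (a b : L2Plane) {R : ℝ} (hR : ‖a + b‖ ≤ R) (ha : ‖a‖ ≤ R) :
    ‖resonantL2 (a + b) (a + b) (a + b) - resonantL2 a a a‖ ≤ 3 * Real.pi * R ^ 2 * ‖b‖ := by
  have h : resonantL2 (a + b) (a + b) (a + b) - resonantL2 a a a =
      resonantL2 b (a + b) (a + b) + resonantL2 a b (a + b) + resonantL2 a a b := by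
    rw [resonantL2_add_fst a b, resonantL2_add_snd a a b, resonantL2_add_trd a a a b]
    abel
  have hR0 : 0 ≤ R := (norm_nonneg a).trans ha
  have b1 : ‖resonantL2 b (a + b) (a + b)‖ ≤ Real.pi * (‖b‖ * R * R) :=
    (norm_resonantL2_le _ _ _).trans (by gcongr)
  have b2 : ‖resonantL2 a b (a + b)‖ ≤ Real.pi * (R * ‖b‖ * R) :=
    (norm_resonantL2_le _ _ _).trans (by gcongr)
  have b3 : ‖resonantL2 a a b‖ ≤ Real.pi * (R * R * ‖b‖) :=
    (norm_resonantL2_le _ _ _).trans (by gcongr)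
  rw [h]
  refine (norm_add₃_le).trans ?_
  linarith

lemma eq_zero_of_norm_deriv_le {f f' : ℝ → L2Plane} {K a b : ℝ}
    (hf : ∀ x ∈ Set.Icc a b, HasDerivWithinAt f (f' x) (Set.Icc a b) x) (ha : f a = 0)
    (bound : ∀ x ∈ Set.Icc a b, ‖f' x‖ ≤ K * ‖f x‖) : ∀ x ∈ Set.Icc a b, f x = 0 :=
  eq_zero_of_abs_deriv_le_mul_abs_self_of_eq_zero_right (fun x hx => (hf x hx).continuousWithinAt)
    (fun x hx => (hf x ⟨hx.1, hx.2.le⟩).mono_of_mem_nhdsWithin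
      (Icc_mem_nhdsGE_of_mem hx))
    ha fun x hx => bound x ⟨hx.1, hx.2.le⟩

/-- Curves with `g' = c 𝓣(g, g, g)` that start in a closed subspace stable under `𝓣` stay there. -/
lemma mem_of_hasDerivWithinAt {V : Submodule ℂ L2Plane}
    (hV : IsClosed (V : Set L2Plane)) (h : ∀ u ∈ V, resonantL2 u u u ∈ V) {c : ℂ} (hc : ‖c‖ = 1)
    {a b : ℝ} {g : ℝ → L2Plane} (hg : ∀ x ∈ Set.Icc a b,
      HasDerivWithinAt g (c • resonantL2 (g x) (g x) (g x)) (Set.Icc a b) x) (ha : g a ∈ V) :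
    ∀ x ∈ Set.Icc a b, g x ∈ V := by
  have : CompleteSpace V := hV.completeSpace_coe
  -- `Q` is the projection onto the orthogonal complement of `V`. The aim is `Q ∘ g = 0`.
  let Q : L2Plane →L[ℂ] L2Plane := ContinuousLinearMap.id ℂ L2Plane - V.starProjection
  have hQ : ∀ v, Q v = v - V.starProjection v := fun v => rfl
  have hP : ∀ v, ‖V.starProjection v‖ ≤ ‖v‖ := fun v => by
    simpa using V.starProjection.le_of_opNorm_le V.starProjection_norm_le v
  have hQn : ∀ v, ‖Q v‖ ≤ 2 * ‖v‖ := fun v => by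
    rw [hQ]
    linarith [norm_sub_le v (V.starProjection v), hP v]
  have hQV : ∀ v, Q v = 0 ↔ v ∈ V := fun v => by
    rw [hQ, sub_eq_zero, eq_comm, Submodule.starProjection_eq_self_iff]
  obtain ⟨R, hR⟩ := isCompact_Icc.exists_bound_of_continuousOn
    fun x hx => (hg x hx).continuousWithinAt
  -- The constant is the Lipschitz constant `3πR²` times the crude bound `2` for the norm of `Q`.
  have key := eq_zero_of_norm_deriv_le (f := fun x => Q (g x)) (K := 6 * Real.pi * R ^ 2)
    (fun x hx => (Q.restrictScalars ℝ).hasFDerivAt.comp_hasDerivWithinAt x (hg x hx))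
    ((hQV _).2 ha) fun x hx => ?_
  · exact fun x hx => (hQV _).1 (key x hx)
  · have e : V.starProjection (g x) + Q (g x) = g x := by rw [hQ]; abel
    have b1 := norm_resonantL2_sub_le (V.starProjection (g x)) (Q (g x)) (R := R)
      (by rw [e]; exact hR x hx) ((hP _).trans (hR x hx))
    rw [e] at b1
    -- With `P` the projection onto `V`, stability gives `Q 𝓣(Pg, Pg, Pg) = 0`. Subtracting it makes
    -- the derivative of `Qg` controlled by `Qg` alone.
    have b2 : Q (resonantL2 (V.starProjection (g x)) (V.starProjection (g x))
        (V.starProjection (g x))) = 0 := (hQV _).2 (h _ (V.starProjection_apply_mem _))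
    have b3 := hQn (resonantL2 (g x) (g x) (g x) - resonantL2 (V.starProjection (g x))
      (V.starProjection (g x)) (V.starProjection (g x)))
    rw [map_sub, b2, sub_zero] at b3
    rw [ContinuousLinearMap.coe_restrictScalars', map_smul, norm_smul, hc, one_mul]
    linarith

/-- A closed subspace that is stable under `𝓣` is dynamically invariant. -/
theorem isDynamicallyInvariant_of_stable {V : Submodule ℂ L2Plane}
    (hV : IsClosed (V : Set L2Plane)) (h : ∀ u ∈ V, resonantL2 u u u ∈ V) :
    IsDynamicallyInvariant V := by
  intro I u hI hu t₀ ht₀ hut₀ t ht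
  rcases le_total t₀ t with hle | hle
  · exact mem_of_hasDerivWithinAt hV h (c := -Complex.I) (by simp)
      (fun x hx => (hu.hasDerivWithinAt (hI.out ht₀ ht hx)).mono (hI.out ht₀ ht)) hut₀ t
      ⟨hle, le_rfl⟩
  -- Backward in time, the reflected curve `x ↦ u(-x)` solves the equation with `i` in place of
  -- `-i`. This is why the preceding lemma admits any unimodular `c`.
  · have hmaps : Set.MapsTo (fun x : ℝ => -x) (Set.Icc (-t₀) (-t)) I := fun x hx =>
      hI.out ht ht₀ ⟨by linarith [hx.2], by linarith [hx.1]⟩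
    have := mem_of_hasDerivWithinAt hV h (c := Complex.I) (by simp) (a := -t₀) (b := -t)
      (g := fun x => u (-x)) (fun x hx => ?_) (by simpa using hut₀) (-t) ⟨by linarith, le_rfl⟩
    · simpa using this
    · have hd := (hu.hasDerivWithinAt (hmaps hx)).scomp x
        ((hasDerivAt_neg x).hasDerivWithinAt) hmaps
      simpa [Function.comp_def] using hd

end ContinuousResonant

/-! ### Assembly -/

open ContinuousResonant in
theorem mainTheorem7 :
    -- the integrals defining `𝓣(φ₁, φ₂, φ₃)` converge absolutely at every point
    (∀ (n₁ m₁ n₂ m₂ n₃ m₃ : ℤ) (z : ℂ),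
      MeasureTheory.Integrable (fun p : ℝ × ℂ =>
        ContinuousResonant.resonantIntegrand (ContinuousResonant.specialHermite n₁ m₁)
          (ContinuousResonant.specialHermite n₂ m₂) (ContinuousResonant.specialHermite n₃ m₃)
          z p.1 p.2)) ∧
    -- the formula for `𝓔` on special Hermite functions
    (∀ n₁ m₁ n₂ m₂ n₃ m₃ n₄ m₄ : ℤ,
      ContinuousResonant.resonantE (ContinuousResonant.specialHermite n₁ m₁)
          (ContinuousResonant.specialHermite n₂ m₂) (ContinuousResonant.specialHermite n₃ m₃)
          (ContinuousResonant.specialHermite n₄ m₄) =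
        if n₁ + n₂ = n₃ + n₄ ∧ m₁ + m₂ = m₃ + m₄ then
          2 * (Real.pi : ℂ) ^ 2 *
            ∫ x : ℂ, ContinuousResonant.specialHermite n₁ m₁ x *
              ContinuousResonant.specialHermite n₂ m₂ x *
              starRingEnd ℂ (ContinuousResonant.specialHermite n₃ m₃ x *
                ContinuousResonant.specialHermite n₄ m₄ x)
        else 0) ∧
    -- the formula for `𝓣` on special Hermite functions
    (∀ n₁ m₁ n₂ m₂ n₃ m₃ n₄ m₄ : ℤ, n₄ = n₁ + n₂ - n₃ → m₄ = m₁ + m₂ - m₃ → ∀ z : ℂ,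
      ContinuousResonant.resonantT (ContinuousResonant.specialHermite n₁ m₁)
          (ContinuousResonant.specialHermite n₂ m₂) (ContinuousResonant.specialHermite n₃ m₃) z =
        ContinuousResonant.resonantE (ContinuousResonant.specialHermite n₁ m₁)
          (ContinuousResonant.specialHermite n₂ m₂) (ContinuousResonant.specialHermite n₃ m₃)
          (ContinuousResonant.specialHermite n₄ m₄) * ContinuousResonant.specialHermite n₄ m₄ z ∧
      ContinuousResonant.resonantT (ContinuousResonant.specialHermite n₁ m₁)
          (ContinuousResonant.specialHermite n₂ m₂) (ContinuousResonant.specialHermite n₃ m₃) z =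
        2 * (Real.pi : ℂ) ^ 2 *
          (∫ x : ℂ, ContinuousResonant.specialHermite n₁ m₁ x *
            ContinuousResonant.specialHermite n₂ m₂ x *
            starRingEnd ℂ (ContinuousResonant.specialHermite n₃ m₃ x *
              ContinuousResonant.specialHermite n₄ m₄ x)) *
          ContinuousResonant.specialHermite n₄ m₄ z) ∧
    -- vanishing of the quartic integral off the resonance `m₁ + m₂ = m₃ + m₄`
    (∀ n₁ m₁ n₂ m₂ n₃ m₃ n₄ m₄ : ℤ, m₁ + m₂ ≠ m₃ + m₄ →
      ∫ x : ℂ, ContinuousResonant.specialHermite n₁ m₁ x *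
        ContinuousResonant.specialHermite n₂ m₂ x *
        starRingEnd ℂ (ContinuousResonant.specialHermite n₃ m₃ x *
          ContinuousResonant.specialHermite n₄ m₄ x) = 0) ∧
    -- every special Hermite function is a stationary wave
    (∀ n m : ℤ, ∃ ω : ℝ,
      (ω : ℂ) = ContinuousResonant.resonantE (ContinuousResonant.specialHermite n m)
        (ContinuousResonant.specialHermite n m) (ContinuousResonant.specialHermite n m)
        (ContinuousResonant.specialHermite n m) ∧
      ContinuousResonant.IsStationaryWave (ContinuousResonant.specialHermiteL2 n m) ω) ∧
    -- dynamically invariant subspaces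
    (∀ α β γ δ : ℤ, ContinuousResonant.IsDynamicallyInvariant
      (ContinuousResonant.hermiteSpan {p : ℤ × ℤ | α * p.1 + β * p.2 ≡ γ [ZMOD δ]})) ∧
    (∀ α β γ : ℤ, ContinuousResonant.IsDynamicallyInvariant
      (ContinuousResonant.hermiteSpan {p : ℤ × ℤ | α * p.1 + β * p.2 = γ})) := by
  refine ⟨fun _ _ _ _ _ _ z => integrable_resonantIntegrand_of_mem (specialHermite_mem _ _)
      (specialHermite_mem _ _) (specialHermite_mem _ _) z, resonantE_specialHermite, ?_,
    fun _ _ _ _ _ _ _ _ => integral_quartic_eq_zero, exists_isStationaryWave,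
    fun α β γ δ => isDynamicallyInvariant_of_stable (Submodule.isClosed_topologicalClosure _)
      fun u hu => resonantL2_mem_hermiteSpan ?_ hu hu hu,
    fun α β γ => isDynamicallyInvariant_of_stable (Submodule.isClosed_topologicalClosure _)
      fun u hu => resonantL2_mem_hermiteSpan ?_ hu hu hu⟩
  · rintro n₁ m₁ n₂ m₂ n₃ m₃ _ _ rfl rfl z
    have h := resonantT_specialHermite n₁ m₁ n₂ m₂ n₃ m₃ z
    rw [resonantE_specialHermite, if_pos ⟨by ring, by ring⟩]
    exact ⟨h, h⟩
  -- Both index sets are level sets of a linear form, taken modulo `δ` or exactly, and `γ + γ - γ =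
  -- γ`.
  · intro p₁ h₁ p₂ h₂ p₃ h₃
    have e := (h₁.add h₂).sub h₃
    simp only [Set.mem_ofPred_eq, Prod.fst_sub, Prod.fst_add, Prod.snd_sub, Prod.snd_add] at *
    convert e using 1 <;> ring
  · intro p₁ h₁ p₂ h₂ p₃ h₃
    simp only [Set.mem_ofPred_eq, Prod.fst_sub, Prod.fst_add, Prod.snd_sub, Prod.snd_add] at *
    linear_combination h₁ + h₂ - h₃
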